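/- **Theorem.** Let $G$ be a finitely presented group acting by isometries on a quasi-tree $X$. If the action is a Bestvina–Fujiwara action, then there is a bushy pseudocharacter $h\colon G\to\mathbb R$. Here: * A *quasi-tree* is a geodesic metric space $X$ (for instance a connected metric graph) with the Bottleneck Property: there is $\Delta>0$ such that any $x,y\in X$ have a midpoint $m$ (so $d(x,m)=d(y,m)=\tfrac12 d(x,y)$) such that every path from $x$ to $y$ contains a point at distance less than $\Delta$ from $m$. * An element $g\in G$ is *hyperbolic* if $t\mapsto g^{\lfloor t\rfloor}x$ is a quasi-geodesic $\mathbb R\to X$ for some $x\in X$. A $(K,L)$-*quasi-axis* of $g$ is a $(K,L)$-quasi-geodesic $c\colon\mathbb R\to X$ on which $g$ acts by a positive translation: $g\,c(t)=c(t+\tau)$ for all $t$, with some $\tau>0$. * Hyperbolic elements $g_1,g_2$ are *independent* if no ray of a quasi-axis of $g_1$ is at finite Hausdorff distance from a ray of a quasi-axis of $g_2$. The action is *nonelementary* if there are two independent hyperbolic elements. * $g_1\sim g_2$ means that there are a constant $B$ and quasi-axes $c_1$ of $g_1$ and $c_2$ of $g_2$ such that for arbitrarily long segments $J$ of $c_1$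 there is $g\in G$ with $gJ$ contained in the $B$-neighbourhood of $c_2$ and with $g\colon J\to gJ$ orientation-preserving, i.e. a point of $c_2$ within $B$ of the terminal endpoint of $gJ$ is ahead, in the orientation of $c_2$, of a point of $c_2$ within $B$ of the initial endpoint. * A *Bestvina–Fujiwara action* is a nonelementary isometric action on a Gromov hyperbolic space for which there are independent hyperbolic $g_1,g_2$ with $g_1\not\sim g_2$. * A *pseudocharacter* is a map $f\colon G\to\mathbb R$ with $f(\alpha^n)=nf(\alpha)$ for all $\alpha\in G$, $n\in\mathbb Z$, and with $|f(\alpha)+f(\beta)-f(\alpha\beta)|$ bounded independently of $\alpha,\beta\in G$. * Let $S$ be a finite generating set. An infinite word $w=w_1w_2\cdots$ in $S\cup S^{-1}$ has sign $\sigma(w)=+1$ (resp. $-1$) if $f(w_1\cdots w_n)\to+\infty$ (resp. $-\infty$), and sign $0$ otherwise. For words of nonzero sign write $w\sim_C v$ if $\sigma(w)=\sigma(v)$ and for every real $D$ with $\sigma(w)D>C$ there are prefixes $w_p$ of $w$ and $v_p$ of $v$ and a finite word $d$ in $S\cup S^{-1}$ with $w_pd=v_p$ in $G$ and $|f(w_pd')-D|\le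 C$ for all prefixes $d'$ of $d$. $E(f)$ is the set of words of nonzero sign modulo the relation $w\sim v$ ($w\sim_C v$ for some $C$), and $E(f)^{\pm}$ is the set of classes of words of sign $\pm1$. * A pseudocharacter $f$ is *bushy* if each of $E(f)^+$ and $E(f)^-$ has at least two elements (for every finite generating set); equivalently, $f\ne0$ and $f$ is neither uniform ($|E(f)|=2$) nor unipotent ($|E(f)^+|=1$ or $|E(f)^-|=1$ but $f$ is not uniform). -/

import Mathlib

open Filter

universe u v

namespace BestvinaFujiwara

/-! ### Coarse geometry -/

section Geometry

variable (X : Type v) [MetricSpace X]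

/-- Any two points are joined by a geodesic segment, i.e. an isometrically embedded interval. -/
def IsGeodesicSpace : Prop :=
  ∀ x y : X, ∃ c : ℝ → X, c 0 = x ∧ c (dist x y) = y ∧
    ∀ s ∈ Set.Icc 0 (dist x y), ∀ t ∈ Set.Icc 0 (dist x y), dist (c s) (c t) = |s - t|

/-- The Bottleneck Property: every pair of points has a midpoint such that all paths between the
two points pass within distance less than `Δ` of it. -/
def BottleneckProperty : Prop :=
  ∃ Δ : ℝ, 0 < Δ ∧ ∀ x y : X, ∃ m : X,
    dist x m = dist x y / 2 ∧ dist y m = dist x y / 2 ∧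
      ∀ p : Path x y, ∃ t, dist (p t) m < Δ

/-- A quasi-tree: a geodesic metric space (for instance a connected metric graph) with the
Bottleneck Property. -/
structure IsQuasiTree : Prop where
  geodesic : IsGeodesicSpace X
  bottleneck : BottleneckProperty X

variable {X}

/-- The Gromov product of `x` and `y` with respect to the base point `o`. -/
noncomputable def gromovProduct (o x y : X) : ℝ := (dist x o + dist y o - dist x y) / 2

variable (X) in
/-- Gromov hyperbolicity, through the `δ`-inequality. -/
def IsGromovHyperbolic : Prop :=
  ∃ δ : ℝ, 0 ≤ δ ∧ ∀ o x y z : X,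
    min (gromovProduct o x z) (gromovProduct o z y) - δ ≤ gromovProduct o x y

/-- `c : ℝ → X` is a (bi-infinite) `(K, L)`-quasi-geodesic. -/
structure IsQuasiGeodesic (K L : ℝ) (c : ℝ → X) : Prop where
  one_le : 1 ≤ K
  nonneg : 0 ≤ L
  lower : ∀ s t : ℝ, |s - t| / K - L ≤ dist (c s) (c t)
  upper : ∀ s t : ℝ, dist (c s) (c t) ≤ K * |s - t| + L

/-- `R` is one of the rays contained in the line `c`. -/
def IsRayOf (c : ℝ → X) (R : Set X) : Prop :=
  ∃ a : ℝ, R = c '' Set.Ici a ∨ R = c '' Set.Iic a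

end Geometry

/-! ### Isometric actions -/

section Action

variable {G : Type u} [Group G] {X : Type v} [MetricSpace X] [MulAction G X]

variable (X) in
/-- `g` acts hyperbolically on `X`: the orbit map `t ↦ g ^ ⌊t⌋ • x` is a quasi-geodesic
(which does not depend on `x` when the action is isometric). -/
def IsHyperbolicElement (g : G) : Prop :=
  ∃ x : X, ∃ K L : ℝ, IsQuasiGeodesic K L fun t : ℝ => g ^ ⌊t⌋ • x

/-- `c` is a `(K, L)`-quasi-axis of `g`, parametrized compatibly with the `g`-orientation:
a `(K, L)`-quasi-geodesic on which `g` acts as a positive translation. -/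
def IsQuasiAxis (K L : ℝ) (g : G) (c : ℝ → X) : Prop :=
  IsQuasiGeodesic K L c ∧ ∃ τ : ℝ, 0 < τ ∧ ∀ t : ℝ, g • c t = c (t + τ)

variable (X) in
/-- `g₁` and `g₂` are independent: their quasi-axes do not contain rays which are a finite
Hausdorff distance apart. -/
def AreIndependent (g₁ g₂ : G) : Prop :=
  ∀ (K L : ℝ) (c₁ c₂ : ℝ → X), IsQuasiAxis K L g₁ c₁ → IsQuasiAxis K L g₂ c₂ →
    ∀ R₁ R₂ : Set X, IsRayOf c₁ R₁ → IsRayOf c₂ R₂ → Metric.hausdorffEDist R₁ R₂ = ⊤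

variable (X) in
/-- The relation `g₁ ∼ g₂`: for arbitrarily long segments `J = c₁ [a, b]` of a quasi-axis of `g₁`
there is `g` such that `g J` lies in the `B`-neighbourhood of a quasi-axis `c₂` of `g₂` and
`g : J → g J` preserves the orientation, i.e. a point of `c₂` within `B` of the terminal endpoint
of `g J` is ahead of a point of `c₂` within `B` of its initial endpoint. The constant `B` may be
any constant not depending on the length of `J`. -/
def AxisEquivalent (g₁ g₂ : G) : Prop :=
  ∃ (K L B : ℝ) (c₁ c₂ : ℝ → X), IsQuasiAxis K L g₁ c₁ ∧ IsQuasiAxis K L g₂ c₂ ∧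
    ∀ T : ℝ, ∃ a b : ℝ, T ≤ b - a ∧ a ≤ b ∧ ∃ g : G,
      (∀ r ∈ Set.Icc a b, ∃ s : ℝ, dist (g • c₁ r) (c₂ s) ≤ B) ∧
      ∃ s t : ℝ, s < t ∧ dist (g • c₁ a) (c₂ s) ≤ B ∧ dist (g • c₁ b) (c₂ t) ≤ B

variable (G X) in
/-- The action is nonelementary: there are two independent hyperbolic elements. -/
def IsNonelementary : Prop :=
  ∃ g₁ g₂ : G, IsHyperbolicElement X g₁ ∧ IsHyperbolicElement X g₂ ∧ AreIndependent X g₁ g₂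

variable (G X) in
/-- A Bestvina–Fujiwara action: a nonelementary isometric action on a Gromov hyperbolic space with
independent hyperbolic elements `g₁`, `g₂` such that `g₁ ≁ g₂`. -/
structure IsBestvinaFujiwaraAction : Prop where
  isometric : IsIsometricSMul G X
  hyperbolic : IsGromovHyperbolic X
  nonelementary : IsNonelementary G X
  exists_inequivalent : ∃ g₁ g₂ : G, IsHyperbolicElement X g₁ ∧ IsHyperbolicElement X g₂ ∧
    AreIndependent X g₁ g₂ ∧ ¬ AxisEquivalent X g₁ g₂

end Action

/-! ### Pseudocharacters and the space `E(f)` -/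

section Pseudocharacters

variable {G : Type u} [Group G]

/-- A pseudocharacter, i.e. a homogeneous quasi-homomorphism. -/
structure IsPseudocharacter (f : G → ℝ) : Prop where
  map_zpow : ∀ (a : G) (n : ℤ), f (a ^ n) = n * f a
  bounded : ∃ C : ℝ, ∀ a b : G, |f a + f b - f (a * b)| ≤ C

/-- The letters `S ∪ S⁻¹`. -/
abbrev Letter (S : Set G) : Type u := {s : G // s ∈ S ∨ s⁻¹ ∈ S}

/-- The group element represented by a finite word. -/
def wordProd {S : Set G} (d : List (Letter S)) : G := (d.map Subtype.val).prod

/-- The group element represented by the prefix of length `n` of an infinite word. -/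
def prefixProd {S : Set G} (w : ℕ → Letter S) (n : ℕ) : G := wordProd ((List.range n).map w)

open Classical in
/-- The sign of an infinite word: `1` (resp. `-1`) if `f` tends to `+∞` (resp. `-∞`) along the
path in the Cayley graph starting at `1` and reading the word, and `0` otherwise. -/
noncomputable def wordSign {S : Set G} (f : G → ℝ) (w : ℕ → Letter S) : ℤ :=
  if Tendsto (fun n => f (prefixProd w n)) atTop atTop then 1
  else if Tendsto (fun n => f (prefixProd w n)) atTop atBot then -1
  else 0

/-- The infinite words of nonzero sign. -/
abbrev SignedWord (f : G → ℝ) (S : Set G) : Type u :=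
  {w : ℕ → Letter S // wordSign f w = 1 ∨ wordSign f w = -1}

/-- The relation `w ∼_C v`: the words have the same sign `σ`, and for all `D` with `σ D > C` there
is a connecting word `d` from a prefix of `w` to a prefix of `v` along which `f` stays within `C`
of `D`. -/
def WordEquivAt {S : Set G} (f : G → ℝ) (C : ℝ) (w v : ℕ → Letter S) : Prop :=
  wordSign f w = wordSign f v ∧
    ∀ D : ℝ, C < wordSign f w * D →
      ∃ (p q : ℕ) (d : List (Letter S)), prefixProd w p * wordProd d = prefixProd v q ∧
        ∀ k ≤ d.length, |f (prefixProd w p * wordProd (d.take k)) - D| ≤ C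

/-- `E(f, S)`: the infinite words of nonzero sign modulo `∼`, where `w ∼ v` if `w ∼_C v` for
some `C`. -/
def EndSpace (f : G → ℝ) (S : Set G) : Type u :=
  Quot fun w v : SignedWord f S => ∃ C : ℝ, WordEquivAt f C w.1 v.1

/-- `E(f, S)⁺`, the set of classes of words of sign `1`. -/
def positiveEnds (f : G → ℝ) (S : Set G) : Set (EndSpace f S) :=
  {e | ∃ w : SignedWord f S, wordSign f w.1 = 1 ∧ Quot.mk _ w = e}

/-- `E(f, S)⁻`, the set of classes of words of sign `-1`. -/
def negativeEnds (f : G → ℝ) (S : Set G) : Set (EndSpace f S) :=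
  {e | ∃ w : SignedWord f S, wordSign f w.1 = -1 ∧ Quot.mk _ w = e}

/-- `f` is a bushy pseudocharacter on the finitely presented group `G`: it is a pseudocharacter
and, for every finite generating set, each of `E(f)⁺` and `E(f)⁻` has at least two elements.
For a nonzero pseudocharacter both sets are nonempty, so this says that `f` is nonzero
and neither uniform nor unipotent. -/
structure IsBushy [Group.IsFinitelyPresented G] (f : G → ℝ) : Prop where
  pseudocharacter : IsPseudocharacter f
  positive : ∀ S : Set G, S.Finite → Subgroup.closure S = ⊤ → 2 ≤ (positiveEnds f S).encard
  negative : ∀ S : Set G, S.Finite → Subgroup.closure S = ⊤ → 2 ≤ (negativeEnds f S).encard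

end Pseudocharacters

end BestvinaFujiwara

/-! Fix independent hyperbolic `g₁ ≁ g₂` and a base point `x`. The pseudocharacter is of counting
type. Put `p = g₁⁻ᴺ x`, `q = g₂⁻ᴺ x` and let oriented jumps from `g p` to `g q` cost `W` less than
their length. The cheapest cost `d` of travelling between two points (`discountDist`) is not
symmetric, and the quasimorphism is `g ↦ d (g x, x) - d (x, g x)`, homogenized at the end.

It is a quasimorphism because of the bottlenecks. A chain of moves and jumps traces a path, which in
a quasi-tree passes near every point of a geodesic between its endpoints and can be cut there at
bounded loss. So `d` is additive along geodesics up to a constant (`exists_discountDist_add_le`),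
and a triangle is handled by cutting its sides at a centre (`exists_discountCocycle_bound`).

It is nonzero on `a = g₁ᴺ g₂⁻ᴺ g₁ᵏ g₂⁻ᵏ` for large `k` and much larger `N`. Independence bounds the
turns of the broken line spelled by the powers of `a`, so that its length is almost the distance of
its ends (`FourPoint.chain`). Forwards, every period contains a jump, and `W` exceeds the loss at
the corners. Backwards, no jump pays (`corner_jump_le`). A paying jump would lay a positive
`g₂`-segment followed by a negative `g₁`-segment, both of exponent `N`, along the line. As `g₁ ≁
g₂`, the former has bounded overlap with the positive `g₁`-pieces of the line and the latter with
its negative `g₂`-pieces (`exists_overlap_le`). The two segments would thus fit into a `g₂⁻¹`-piece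
and the next `g₁`-piece, but the exponents of such a pair are `N, k` or `k, N`, never `N, N`. Two
exponents are needed since `g₁` and `g₂` may be equivalent to their own inverses.

For bushiness, the pseudocharacter is bounded by displacement plus a constant, so words connecting
prefixes at a high level stay far from `x`. Hence equivalent words are joined outside every ball,
which a bottleneck forbids for words that diverge. The elements `a` and `g₁⁻ᴺ a g₁ᴺ` have the same
value, and their powers diverge both forwards and backwards. -/

namespace BestvinaFujiwara

/-! ### Hyperbolic geometry -/

section Hyperbolic

variable {X : Type v} [MetricSpace X]

/-- The four-point condition with constant `δ`. -/
def FourPoint (X : Type v) [MetricSpace X] (δ : ℝ) : Prop :=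
  ∀ x y z w : X, dist x y + dist z w ≤ dist x z + dist y w + 2 * δ ∨
    dist x y + dist z w ≤ dist x w + dist y z + 2 * δ

theorem IsGromovHyperbolic.fourPoint (h : IsGromovHyperbolic X) :
    ∃ δ : ℝ, 0 ≤ δ ∧ FourPoint X δ := by
  obtain ⟨δ, hδ, H⟩ := h
  refine ⟨δ, hδ, fun x y z w => ?_⟩
  have h := H w x y z
  simp only [gromovProduct] at h
  have h1 := dist_comm z y
  rcases min_le_iff.mp (sub_le_iff_le_add.mp h) with h | h
  · left; linarith
  · right; linarith

theorem gromovProduct_comm (o x y : X) : gromovProduct o x y = gromovProduct o y x := by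
  simp only [gromovProduct, dist_comm x y]; ring

theorem gromovProduct_nonneg (o x y : X) : 0 ≤ gromovProduct o x y := by
  have := dist_triangle x o y
  have := dist_comm o y
  unfold gromovProduct; linarith

theorem gromovProduct_le_left (o x y : X) : gromovProduct o x y ≤ dist o x := by
  have := dist_triangle y x o
  have := dist_comm x y
  have := dist_comm x o
  unfold gromovProduct; linarith

theorem gromovProduct_add (o x y : X) :
    gromovProduct o x y + gromovProduct x o y = dist o x := by
  have := dist_comm x y
  have := dist_comm o x
  have := dist_comm o y
  unfold gromovProduct; linarith

theorem gromovProduct_self_left (o y : X) : gromovProduct o o y = 0 := by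
  simp [gromovProduct, dist_comm]

theorem gromovProduct_self_right (o y : X) : gromovProduct o y o = 0 := by
  simp [gromovProduct]

theorem FourPoint.gromovProduct_le {δ : ℝ} (h : FourPoint X δ) (o x y z : X) :
    gromovProduct o x z - δ ≤ gromovProduct o x y ∨
      gromovProduct o z y - δ ≤ gromovProduct o x y := by
  have h1 := dist_comm z y
  simp only [gromovProduct]
  rcases h x y z o with h | h
  · left; linarith
  · right; linarith

/-- Two consecutive small Gromov products separated by a long step can be merged. -/
theorem FourPoint.step {δ C : ℝ} (h : FourPoint X δ) {u v w z : X}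
    (h1 : gromovProduct v u w ≤ C) (h2 : gromovProduct w v z ≤ C)
    (hd : 2 * C + δ < dist v w) : gromovProduct v u z ≤ C + δ := by
  have h3 := gromovProduct_add v w z
  -- The second alternative is impossible: the product of `w` and `z` at `v` is `dist v w` minus
  -- their product at `w`, hence exceeds `C + δ`.
  rcases h.gromovProduct_le v u w z with h | h
  · linarith
  · rw [gromovProduct_comm] at h; linarith

/-- Local-to-global principle for broken geodesics. -/
theorem FourPoint.chain {δ C : ℝ} (h : FourPoint X δ) (hδ : 0 ≤ δ) (hC : 0 ≤ C) {u : ℤ → X}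
    (h1 : ∀ i, gromovProduct (u i) (u (i - 1)) (u (i + 1)) ≤ C)
    (hd : ∀ i, 2 * C + 4 * δ < dist (u i) (u (i + 1))) {i j k : ℤ} (hij : i ≤ j) (hjk : j ≤ k) :
    gromovProduct (u j) (u i) (u k) ≤ C + 2 * δ := by
  -- The error does not accumulate: the inductive bound only serves to exclude one alternative, and
  -- the estimate itself comes from the local turn. Extending forwards costs one `δ`, extending
  -- backwards in `B` a second one.
  have A : ∀ n : ℕ, ∀ j : ℤ, gromovProduct (u j) (u (j - 1)) (u (j + n)) ≤ C + δ := by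
    intro n
    induction n with
    | zero => intro j; simp [gromovProduct_self_right]; positivity
    | succ n ih =>
      intro j
      rcases h.gromovProduct_le (u j) (u (j - 1)) (u (j + 1)) (u (j + (n + 1 : ℕ))) with h | h
      · linarith [h1 j]
      · have e1 := ih (j + 1)
        have e2 := gromovProduct_add (u j) (u (j + 1)) (u (j + (n + 1 : ℕ)))
        have e3 := hd j
        have e4 := h1 j
        rw [gromovProduct_comm (u j)] at h
        simp only [add_sub_cancel_right] at e1
        rw [show j + 1 + (n : ℤ) = j + (n + 1 : ℕ) by push_cast; ring] at e1
        linarith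
  have B : ∀ n : ℕ, ∀ j k : ℤ, j ≤ k → gromovProduct (u j) (u (j - n)) (u k) ≤ C + 2 * δ := by
    intro n
    induction n with
    | zero => intro j k _; simp [gromovProduct_self_left]; positivity
    | succ n ih =>
      intro j k hjk
      obtain ⟨m, rfl⟩ : ∃ m : ℕ, k = j + m := ⟨(k - j).toNat, by omega⟩
      rcases h.gromovProduct_le (u j) (u (j - 1)) (u (j + m)) (u (j - (n + 1 : ℕ))) with h | h
      · have e1 := ih (j - 1) j (by omega)
        rw [show j - 1 - (n : ℤ) = j - (n + 1 : ℕ) by push_cast; ring] at e1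
        have e2 := gromovProduct_add (u j) (u (j - 1)) (u (j - (n + 1 : ℕ)))
        have e3 := hd (j - 1)
        simp only [sub_add_cancel] at e3
        rw [dist_comm] at e3
        rw [gromovProduct_comm] at e1
        have e4 := A m j
        linarith
      · linarith [A m j]
  obtain ⟨m, rfl⟩ : ∃ m : ℕ, i = j - m := ⟨(j - i).toNat, by omega⟩
  exact B m j k hjk

/-- Points close to a geodesic at the same position are close to each other. -/
theorem FourPoint.dist_le_of_position {δ B e : ℝ} (h : FourPoint X δ) {x y v w : X}
    (hv : gromovProduct v x y ≤ B) (hw : gromovProduct w x y ≤ B)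
    (hp : |dist x v - dist x w| ≤ e) : dist v w ≤ 2 * B + e + 2 * δ := by
  unfold gromovProduct at hv hw
  have h1 := abs_le.mp hp
  rcases h x y v w with h | h <;> linarith

/-- If `v`, `w` are close to a geodesic from `x` to `y`, in this order, and `m` is close to a
geodesic from `v` to `w`, then going through `v`, `m`, `w` is almost optimal. -/
theorem FourPoint.dist_add_le {δ B C : ℝ} (h : FourPoint X δ) {x y v w m : X}
    (hv : gromovProduct v x y ≤ B) (hw : gromovProduct w x y ≤ B) (hvw : dist x v ≤ dist x w)
    (hm : gromovProduct m v w ≤ C) :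
    dist x v + dist v m + dist m w + dist w y ≤ dist x y + (2 * C + 4 * B + 2 * δ) := by
  have c1 := dist_comm w y
  have c2 := dist_comm v y
  have c3 := dist_comm w m
  have hB : 0 ≤ B := (gromovProduct_nonneg _ _ _).trans hv
  unfold gromovProduct at hv hw hm
  rcases h x y v w with h | h <;> linarith

theorem FourPoint.gromovProduct_mid {δ B C : ℝ} (h : FourPoint X δ) {x y v w m : X}
    (hv : gromovProduct v x y ≤ B) (hw : gromovProduct w x y ≤ B) (hvw : dist x v ≤ dist x w)
    (hm : gromovProduct m v w ≤ C) : gromovProduct m x y ≤ C + 2 * B + δ := by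
  have h1 := h.dist_add_le hv hw hvw hm
  have h2 := dist_triangle x v m
  have h3 := dist_triangle m w y
  have c1 := dist_comm y m
  unfold gromovProduct; linarith

/-- Two almost geodesic rays issued from `o` in different directions. -/
theorem FourPoint.two_rays {δ C : ℝ} (h : FourPoint X δ) (hδ : 0 ≤ δ) {o p q y z : X}
    (h1 : gromovProduct o p q ≤ C) (hp : gromovProduct p o y ≤ C) (hq : gromovProduct q o z ≤ C)
    (dp : 2 * C + 3 * δ < dist o p) (dq : 2 * C + 3 * δ < dist o q) :
    gromovProduct o y z ≤ C + 2 * δ := by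
  have e1 : gromovProduct o q y ≤ C + δ :=
    h.step (by rwa [gromovProduct_comm]) hp (by linarith)
  have e2 : gromovProduct o y z ≤ C + δ + δ :=
    h.step (by rwa [gromovProduct_comm]) (hq.trans (by linarith)) (by linarith)
  linarith

/-- The centre of a geodesic triangle. -/
theorem FourPoint.exists_center {δ : ℝ} (h : FourPoint X δ) (hδ : 0 ≤ δ)
    (hX : IsGeodesicSpace X) (x y z : X) :
    ∃ m, gromovProduct m x y ≤ δ ∧ gromovProduct m y z ≤ δ ∧ gromovProduct m z x ≤ δ := by
  obtain ⟨c, c0, c1, hc⟩ := hX x y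
  -- The centre is the point of a geodesic from `x` to `y` where the inscribed tripod branches.
  set s := gromovProduct x y z with hs
  have s0 : 0 ≤ s := gromovProduct_nonneg _ _ _
  have s1 : s ≤ dist x y := gromovProduct_le_left _ _ _
  have d1 := hc 0 ⟨le_rfl, dist_nonneg⟩ s ⟨s0, s1⟩
  have d2 := hc s ⟨s0, s1⟩ _ ⟨dist_nonneg, le_rfl⟩
  rw [c0, zero_sub, abs_neg, abs_of_nonneg s0] at d1
  rw [c1, abs_sub_comm, abs_of_nonneg (by linarith)] at d2
  have k1 := dist_comm x (c s)
  have k2 := dist_comm y (c s)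
  have k3 := dist_comm z (c s)
  have k4 := dist_comm x z
  have k5 := dist_comm x y
  have k6 := dist_comm y z
  simp only [gromovProduct] at hs
  have h4 := h x y (c s) z
  refine ⟨c s, ?_, ?_, ?_⟩ <;> simp only [gromovProduct] <;> rcases h4 with h4 | h4 <;> linarith

end Hyperbolic

/-! ### The bottleneck property -/

section Bottleneck

variable {X : Type v} [MetricSpace X]

/-- A geodesic as a path all of whose points lie between the endpoints. -/
theorem IsGeodesicSpace.exists_path (hX : IsGeodesicSpace X) (x y : X) :
    ∃ p : Path x y, ∀ t, dist x (p t) + dist (p t) y = dist x y := by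
  obtain ⟨c, c0, c1, hc⟩ := hX x y
  have hD : 0 ≤ dist x y := dist_nonneg
  have hm : ∀ t : unitInterval, (t : ℝ) * dist x y ∈ Set.Icc 0 (dist x y) := fun t =>
    ⟨mul_nonneg t.2.1 hD, by nlinarith [t.2.2]⟩
  refine ⟨⟨⟨fun t => c (t * dist x y), ?_⟩, by simp [c0], by simp [c1]⟩, fun t => ?_⟩
  · refine (LipschitzWith.of_dist_le_mul (K := ⟨dist x y, hD⟩) fun s t => ?_).continuous
    rw [hc _ (hm s) _ (hm t), ← sub_mul, abs_mul, abs_of_nonneg hD, mul_comm]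
    rfl
  · have d1 := hc 0 ⟨le_rfl, hD⟩ _ (hm t)
    have d2 := hc _ (hm t) _ ⟨hD, le_rfl⟩
    rw [c0, zero_sub, abs_neg, abs_of_nonneg (hm t).1] at d1
    rw [c1, abs_sub_comm, abs_of_nonneg (by linarith [(hm t).2])] at d2
    change dist x (c _) + dist (c _) y = _
    linarith

theorem IsGeodesicSpace.exists_between (hX : IsGeodesicSpace X) {x y : X} {s : ℝ} (s0 : 0 ≤ s)
    (s1 : s ≤ dist x y) : ∃ z, dist x z = s ∧ dist z y = dist x y - s := by
  obtain ⟨c, c0, c1, hc⟩ := hX x y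
  have d1 := hc 0 ⟨le_rfl, dist_nonneg⟩ s ⟨s0, s1⟩
  have d2 := hc s ⟨s0, s1⟩ _ ⟨dist_nonneg, le_rfl⟩
  rw [c0, zero_sub, abs_neg, abs_of_nonneg s0] at d1
  rw [c1, abs_sub_comm, abs_of_nonneg (by linarith)] at d2
  exact ⟨c s, d1, d2⟩

/-- In a quasi-tree, every point close to a geodesic is a bottleneck. -/
theorem IsQuasiTree.exists_bottleneck {δ : ℝ} (hX : IsQuasiTree X) (h : FourPoint X δ) (e : ℝ) :
    ∃ R, 0 < R ∧ ∀ x y z : X, gromovProduct z x y ≤ e → ∀ p : Path x y, ∃ t, dist (p t) z ≤ R := by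
  obtain ⟨Δ, hΔ, H⟩ := hX.bottleneck
  -- points on the first half of a geodesic
  have A : ∀ x y z : X, dist x z + dist z y = dist x y → dist x z ≤ dist z y →
      ∀ p : Path x y, ∃ t, dist (p t) z ≤ Δ + 2 * |δ| := by
    intro x y z hz hle p
    -- The bottleneck property only concerns midpoints, so `y'` is chosen to make `z` a midpoint of
    -- `x` and `y'`, and the path is prolonged from `y` to `y'`. Any two midpoints are within `2 *
    -- |δ|`.
    obtain ⟨y', hy1, hy2⟩ := hX.geodesic.exists_between (x := z) (y := y) dist_nonneg hle
    obtain ⟨m, m1, m2, hm⟩ := H x y'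
    obtain ⟨q, hq⟩ := hX.geodesic.exists_path y y'
    have hxy' : dist x y' = 2 * dist x z := by
      have := dist_triangle x z y'
      have := dist_triangle x y' y
      linarith
    have hmz : dist m z ≤ 2 * |δ| := by
      have := le_abs_self δ
      have := dist_comm y' z
      rcases h x y' m z with h | h <;> linarith
    obtain ⟨t, ht⟩ := hm (p.trans q)
    have ht' : dist ((p.trans q) t) z ≤ Δ + 2 * |δ| := by
      linarith [dist_triangle ((p.trans q) t) m z]
    have : (p.trans q) t ∈ Set.range p ∪ Set.range q := by
      rw [← Path.trans_range]; exact ⟨t, rfl⟩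
    rcases this with ⟨s, hs⟩ | ⟨s, hs⟩
    · exact ⟨s, by rw [hs]; exact ht'⟩
    -- A geodesic from `y` to `y'` keeps distance at least `dist y' z = dist x z` from `z`. If it
    -- comes close to `z`, the starting point `x` is already close.
    · refine ⟨0, ?_⟩
      rw [p.source]
      have := hq s
      have := dist_triangle y' (q s) z
      have := dist_triangle y (q s) z
      have := dist_comm y y'
      have := dist_comm y z
      have := dist_comm y' z
      have := dist_comm y' (q s)
      rw [← hs] at ht'
      linarith
  have A' : ∀ x y z : X, dist x z + dist z y = dist x y →
      ∀ p : Path x y, ∃ t, dist (p t) z ≤ Δ + 2 * |δ| := by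
    intro x y z hz p
    rcases le_total (dist x z) (dist z y) with hle | hle
    · exact A x y z hz hle p
    · obtain ⟨t, ht⟩ := A y x z (by rw [dist_comm y z, dist_comm z x, dist_comm y x]; linarith)
        (by rwa [dist_comm y z, dist_comm z x]) p.symm
      exact ⟨unitInterval.symm t, by simpa [Path.symm] using ht⟩
  refine ⟨Δ + 2 * |δ| + (2 * |e| + 2 * |e| + 2 * |δ|), by positivity, fun x y z hz p => ?_⟩
  have he := le_abs_self e
  have hd := le_abs_self δ
  -- A point exactly on a geodesic, at the position of `z`; the minimum is needed because `z` may
  -- lie slightly beyond `y`.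
  obtain ⟨z', h1, h2⟩ := hX.geodesic.exists_between (x := x) (y := y)
    (s := min (dist x z) (dist x y)) (by positivity) (min_le_right _ _)
  obtain ⟨t, ht⟩ := A' x y z' (by linarith) p
  have h3 : gromovProduct z' x y ≤ |e| := by
    have := abs_nonneg e
    have := dist_comm y z'
    unfold gromovProduct; linarith
  have h4 : |dist x z' - dist x z| ≤ 2 * |e| := by
    rw [h1]
    unfold gromovProduct at hz
    have : dist x z ≤ dist x y + 2 * e := by linarith [dist_nonneg (x := y) (y := z)]
    rw [abs_le]
    rcases min_cases (dist x z) (dist x y) with ⟨h, _⟩ | ⟨h, _⟩ <;> constructor <;>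
      linarith [abs_nonneg e]
  have h5 := h.dist_le_of_position h3 (hz.trans he) h4
  exact ⟨t, by linarith [dist_triangle (p t) z' z]⟩

end Bottleneck

/-- A discrete intermediate value theorem. -/
theorem exists_nat_abs_sub_le {f : ℕ → ℝ} {M s : ℝ} {n : ℕ} (hM : ∀ i, |f (i + 1) - f i| ≤ M)
    {a : ℕ} (ha : a ≤ n) (h0 : f a ≤ s) (h1 : s ≤ f n) : ∃ m, a ≤ m ∧ m ≤ n ∧ |f m - s| ≤ M := by
  classical
  have hex : ∃ m, a ≤ m ∧ s ≤ f m := ⟨n, ha, h1⟩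
  obtain ⟨m1, m2⟩ := Nat.find_spec hex
  refine ⟨Nat.find hex, m1, Nat.find_min' hex ⟨ha, h1⟩, ?_⟩
  set m := Nat.find hex with hm
  rw [abs_of_nonneg (by linarith)]
  rcases m1.eq_or_lt with h | h
  · rw [← h]; rw [← h] at m2; linarith [(abs_nonneg _).trans (hM 0)]
  · have h2 : ¬ (a ≤ m - 1 ∧ s ≤ f (m - 1)) := Nat.find_min hex (by omega)
    have h3 : f (m - 1) < s := by
      by_contra h4
      exact h2 ⟨by omega, by linarith⟩
    have h4 := (le_abs_self _).trans (hM (m - 1))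
    rw [show m - 1 + 1 = m by omega] at h4
    linarith

end BestvinaFujiwara

namespace BestvinaFujiwara

/-! ### Orbits of hyperbolic elements -/

theorem isRayOf_orbit {G : Type u} [Group G] {X : Type v} [MulAction G X] (g : G) (x : X)
    {ε : ℤ} (hε : ε = 1 ∨ ε = -1) :
    IsRayOf (fun t : ℝ => g ^ ⌊t⌋ • x) (Set.range fun n : ℕ => g ^ (ε * n) • x) := by
  refine ⟨0, ?_⟩
  rcases hε with rfl | rfl
  · left
    ext y
    constructor
    · rintro ⟨n, rfl⟩
      exact ⟨n, by simp, by simp⟩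
    · rintro ⟨t, ht, rfl⟩
      have : 0 ≤ ⌊t⌋ := Int.floor_nonneg.mpr ht
      exact ⟨⌊t⌋.toNat, by simp [Int.toNat_of_nonneg this]⟩
  · right
    ext y
    constructor
    · rintro ⟨n, rfl⟩
      refine ⟨((-n : ℤ) : ℝ), by simp, by simp [Int.floor_neg]⟩
    · rintro ⟨t, ht, rfl⟩
      have : ⌊t⌋ ≤ 0 := by
        have h1 : (⌊t⌋ : ℝ) ≤ 0 := (Int.floor_le t).trans ht
        exact_mod_cast h1
      refine ⟨(-⌊t⌋).toNat, ?_⟩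
      have h2 : (((-⌊t⌋).toNat : ℕ) : ℤ) = -⌊t⌋ := Int.toNat_of_nonneg (by omega)
      simp only [h2]
      simp

section Orbits

variable {G : Type u} [Group G] {X : Type v} [MetricSpace X] [MulAction G X]

theorem IsQuasiGeodesic.mono {K L K' L' : ℝ} {c : ℝ → X} (h : IsQuasiGeodesic K L c)
    (hK : K ≤ K') (hL : L ≤ L') : IsQuasiGeodesic K' L' c where
  one_le := h.one_le.trans hK
  nonneg := h.nonneg.trans hL
  lower s t := by
    have h1 : |s - t| / K' ≤ |s - t| / K :=
      div_le_div_of_nonneg_left (abs_nonneg _) (by linarith [h.one_le]) hK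
    linarith [h.lower s t]
  upper s t := by
    have h1 : K * |s - t| ≤ K' * |s - t| := mul_le_mul_of_nonneg_right hK (abs_nonneg _)
    linarith [h.upper s t]

theorem isQuasiAxis_orbit {K L : ℝ} {g : G} {x : X}
    (h : IsQuasiGeodesic K L fun t : ℝ => g ^ ⌊t⌋ • x) :
    IsQuasiAxis K L g fun t : ℝ => g ^ ⌊t⌋ • x :=
  ⟨h, 1, one_pos, fun t => by simp only [Int.floor_add_one, zpow_add_one, smul_smul, mul_self_zpow]⟩

theorem IsQuasiGeodesic.dist_zpow {K L : ℝ} {g : G} {x : X}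
    (h : IsQuasiGeodesic K L fun t : ℝ => g ^ ⌊t⌋ • x) (i j : ℤ) :
    |(i : ℝ) - j| / K - L ≤ dist (g ^ i • x) (g ^ j • x) ∧
      dist (g ^ i • x) (g ^ j • x) ≤ K * |(i : ℝ) - j| + L := by
  have h1 := h.lower i j
  have h2 := h.upper i j
  simp only [Int.floor_intCast] at h1 h2
  exact ⟨h1, h2⟩

/-- `g` acts on the orbit of `x` as a translation of a coarse geodesic. -/
def MorseOrbit (C : ℝ) (g : G) (x : X) : Prop :=
  ∀ i j k : ℤ, i ≤ j → j ≤ k → gromovProduct (g ^ j • x) (g ^ i • x) (g ^ k • x) ≤ C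

theorem MorseOrbit.ray {C : ℝ} {g : G} {x : X} (h : MorseOrbit C g x) {ε : ℤ}
    (hε : ε = 1 ∨ ε = -1) (j k : ℕ) (hjk : j ≤ k) :
    gromovProduct (g ^ (ε * j) • x) x (g ^ (ε * k) • x) ≤ C := by
  rcases hε with rfl | rfl
  · simpa using h 0 j k (by positivity) (by exact_mod_cast hjk)
  · rw [gromovProduct_comm]
    simpa using h (-k) (-j) 0 (by omega) (by omega)

variable [IsIsometricSMul G X]

theorem gromovProduct_smul (g : G) (o x y : X) :
    gromovProduct (g • o) (g • x) (g • y) = gromovProduct o x y := by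
  simp [gromovProduct]

theorem dist_smul_zpow (g : G) (x : X) (i j : ℤ) :
    dist (g ^ i • x) (g ^ j • x) = dist x (g ^ (j - i) • x) := by
  rw [← dist_smul (g ^ i) x, smul_smul, ← zpow_add]; congr 3; ring

theorem dist_mul_smul (a b : G) (x : X) : dist (a • x) ((a * b) • x) = dist x (b • x) := by
  rw [mul_smul, dist_smul]

theorem dist_smul_inv (a : G) (x : X) : dist x (a⁻¹ • x) = dist x (a • x) := by
  rw [← dist_smul a, smul_inv_smul, dist_comm]

theorem IsHyperbolicElement.quasiGeodesic {g : G} (h : IsHyperbolicElement X g) (x : X) :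
    ∃ K L : ℝ, IsQuasiGeodesic K L fun t : ℝ => g ^ ⌊t⌋ • x := by
  obtain ⟨y, K, L, hy⟩ := h
  have hd : ∀ i j : ℤ, |dist (g ^ i • x) (g ^ j • x) - dist (g ^ i • y) (g ^ j • y)|
      ≤ 2 * dist x y := by
    intro i j
    have h1 := dist_dist_dist_le (g ^ i • x) (g ^ j • x) (g ^ i • y) (g ^ j • y)
    rw [Real.dist_eq, dist_smul, dist_smul] at h1
    linarith
  refine ⟨K, L + 2 * dist x y, hy.one_le, add_nonneg hy.nonneg (by positivity), fun s t => ?_,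
    fun s t => ?_⟩
  · have := hy.lower s t
    have := (abs_le.mp (hd ⌊s⌋ ⌊t⌋)).1
    linarith
  · have := hy.upper s t
    have := (abs_le.mp (hd ⌊s⌋ ⌊t⌋)).2
    linarith

/-- Bottlenecks constrain continuous paths, so the discrete orbit has to be filled in by geodesics.
-/
theorem exists_path_zpow (hX : IsGeodesicSpace X) (g : G) (x : X) (i : ℤ) (n : ℕ) :
    ∃ p : Path (g ^ i • x) (g ^ (i + n) • x), ∀ t, ∃ s : ℤ,
      i ≤ s ∧ s ≤ i + n ∧ dist (p t) (g ^ s • x) ≤ dist x (g • x) := by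
  induction n with
  | zero =>
    refine ⟨(Path.refl _).cast rfl (by simp), fun t => ⟨i, le_rfl, by simp, ?_⟩⟩
    simp
  | succ n ih =>
    obtain ⟨p, hp⟩ := ih
    obtain ⟨q, hq⟩ := hX.exists_path (g ^ (i + n) • x) (g ^ (i + (n + 1 : ℕ)) • x)
    refine ⟨p.trans q, fun t => ?_⟩
    have : (p.trans q) t ∈ Set.range p ∪ Set.range q := by
      rw [← Path.trans_range]; exact ⟨t, rfl⟩
    rcases this with ⟨s, hs⟩ | ⟨s, hs⟩
    · obtain ⟨k, h1, h2, h3⟩ := hp s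
      exact ⟨k, h1, by push_cast; omega, by rw [← hs]; exact h3⟩
    · refine ⟨i + n, by omega, by push_cast; omega, ?_⟩
      have h1 := hq s
      rw [dist_smul_zpow, show i + ((n + 1 : ℕ) : ℤ) - (i + n) = 1 by push_cast; ring, zpow_one]
        at h1
      rw [← hs, dist_comm]
      linarith [dist_nonneg (x := q s) (y := g ^ (i + (n + 1 : ℕ)) • x)]

/-- Orbits of hyperbolic elements of a quasi-tree satisfy the Morse lemma. -/
theorem IsHyperbolicElement.exists_morseOrbit {δ : ℝ} (hX : IsQuasiTree X) (h4 : FourPoint X δ)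
    {g : G} (h : IsHyperbolicElement X g) (x : X) : ∃ C, MorseOrbit C g x := by
  classical
  obtain ⟨K, L, hKL⟩ := h.quasiGeodesic x
  obtain ⟨R, hR, H⟩ := hX.exists_bottleneck h4 0
  have K1 := hKL.one_le
  set R' := R + dist x (g • x) with hR'
  refine ⟨R' + 1 + (K * (K * (2 * R' + 1 + L)) + L), fun i j k hij hjk => ?_⟩
  obtain ⟨c, c0, c1, hc⟩ := hX.geodesic (g ^ i • x) (g ^ k • x)
  set D := dist (g ^ i • x) (g ^ k • x) with hD
  have D0 : 0 ≤ D := dist_nonneg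
  have hl : ∀ t ∈ Set.Icc 0 D, dist (g ^ i • x) (c t) = t := fun t ht => by
    rw [← c0, hc 0 ⟨le_rfl, D0⟩ t ht, zero_sub, abs_neg, abs_of_nonneg ht.1]
  have hr : ∀ t ∈ Set.Icc 0 D, dist (c t) (g ^ k • x) = D - t := fun t ht => by
    rw [← c1, hc t ht D ⟨D0, le_rfl⟩, abs_sub_comm, abs_of_nonneg (by linarith [ht.2])]
  have hnear : ∀ t ∈ Set.Icc 0 D, ∃ s : ℤ, dist (c t) (g ^ s • x) ≤ R' := by
    intro t ht
    obtain ⟨p, hp⟩ := exists_path_zpow hX.geodesic g x i (k - i).toNat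
    have hk : i + ((k - i).toNat : ℤ) = k := by omega
    obtain ⟨r, hr⟩ := H (g ^ i • x) (g ^ k • x) (c t) (by
      rw [gromovProduct, hl t ht, dist_comm (g ^ k • x), hr t ht]; linarith)
      (p.cast rfl (by rw [hk]))
    obtain ⟨s, -, -, hs⟩ := hp r
    refine ⟨s, ?_⟩
    have h1 := dist_triangle (c t) (p r) (g ^ s • x)
    rw [dist_comm (c t) (p r)] at h1
    have h2 : dist (p r) (c t) ≤ R := hr
    linarith
  have hmem : ∀ n : ℕ, min (n : ℝ) D ∈ Set.Icc 0 D := fun n => ⟨by positivity, min_le_right _ _⟩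
  -- Walk along the geodesic in unit steps up to the first point near some `g ^ s' • x` with `j ≤
  -- s'`. The preceding point is near an orbit point of index at most `j`. The indices on the two
  -- sides of `j` are boundedly far apart, so `g ^ j • x` is also near the geodesic.
  have hex : ∃ n : ℕ, ∃ s : ℤ, j ≤ s ∧ dist (c (min (n : ℝ) D)) (g ^ s • x) ≤ R' := by
    refine ⟨⌈D⌉₊, k, hjk, ?_⟩
    rw [min_eq_right (Nat.le_ceil D), c1, dist_self]
    positivity
  obtain ⟨s', hs', ds'⟩ := Nat.find_spec hex
  set n := Nat.find hex with hn
  obtain ⟨s, hs, ds⟩ : ∃ s : ℤ, s ≤ j ∧ dist (c (min (n : ℝ) D)) (g ^ s • x) ≤ R' + 1 := by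
    rcases Nat.eq_zero_or_pos n with h0 | h0
    · refine ⟨i, hij, ?_⟩
      rw [h0, Nat.cast_zero, min_eq_left D0, c0, dist_self]
      positivity
    · obtain ⟨s, hs⟩ := hnear _ (hmem (n - 1))
      have hmin := Nat.find_min hex (m := n - 1) (by omega)
      refine ⟨s, ?_, ?_⟩
      · by_contra hlt
        exact hmin ⟨s, by omega, hs⟩
      · have h1 := hc _ (hmem n) _ (hmem (n - 1))
        have h2 : |min (n : ℝ) D - min ((n - 1 : ℕ) : ℝ) D| ≤ 1 := by
          refine (abs_min_sub_min_le_max _ _ _ _).trans ?_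
          rw [Nat.cast_sub h0]
          simp
        linarith [dist_triangle (c (min (n : ℝ) D)) (c (min ((n - 1 : ℕ) : ℝ) D)) (g ^ s • x)]
  set z := c (min (n : ℝ) D) with hz
  have e1 : dist (g ^ s • x) (g ^ s' • x) ≤ 2 * R' + 1 := by
    have := dist_triangle (g ^ s • x) z (g ^ s' • x)
    rw [dist_comm _ z] at this
    linarith
  have e2 := (hKL.dist_zpow s s').1
  have e3 := (hKL.dist_zpow s j).2
  have hss : |(s : ℝ) - s'| = s' - s := by
    rw [abs_sub_comm, abs_of_nonneg]; exact_mod_cast sub_nonneg.mpr (hs.trans hs')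
  have hsj : |(s : ℝ) - j| = j - s := by
    rw [abs_sub_comm, abs_of_nonneg]; exact_mod_cast sub_nonneg.mpr hs
  have hjs : (j : ℝ) ≤ s' := by exact_mod_cast hs'
  rw [hss] at e2
  rw [hsj] at e3
  have e4 : (s' : ℝ) - s ≤ K * (2 * R' + 1 + L) := by
    have : ((s' : ℝ) - s) / K ≤ 2 * R' + 1 + L := by linarith
    rwa [div_le_iff₀ (by linarith), mul_comm] at this
  have e5 : K * ((j : ℝ) - s) ≤ K * (K * (2 * R' + 1 + L)) :=
    mul_le_mul_of_nonneg_left (by linarith) (by linarith)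
  have e6 := dist_triangle z (g ^ s • x) (g ^ j • x)
  have e7 := hl _ (hmem n)
  have e8 := hr _ (hmem n)
  rw [← hz] at e7 e8
  have e9 := dist_triangle (g ^ i • x) z (g ^ j • x)
  have e10 := dist_triangle (g ^ j • x) z (g ^ k • x)
  rw [dist_comm _ z] at e10
  rw [gromovProduct, ← hD, dist_comm (g ^ k • x)]
  linarith

theorem IsHyperbolicElement.exists_le_dist {g : G} (h : IsHyperbolicElement X g) (x : X) (R : ℝ) :
    ∃ n₀ : ℕ, ∀ n : ℕ, n₀ ≤ n → R ≤ dist x (g ^ n • x) := by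
  obtain ⟨K, L, hKL⟩ := h.quasiGeodesic x
  have K0 : 0 < K := by linarith [hKL.one_le]
  obtain ⟨n₀, hn⟩ := exists_nat_ge (K * (R + L))
  refine ⟨n₀, fun n hnn => ?_⟩
  have h1 := (hKL.dist_zpow 0 n).1
  simp only [zpow_zero, one_smul, zpow_natCast, Int.cast_zero, zero_sub, abs_neg, Int.cast_natCast,
    Nat.abs_cast] at h1
  have h2 : (n₀ : ℝ) ≤ n := by exact_mod_cast hnn
  have h3 : R + L ≤ n / K := by rw [le_div_iff₀ K0, mul_comm]; linarith
  linarith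

/-- If the Gromov product of two coarse rays is unbounded then the first ray stays close to the
second one. -/
theorem FourPoint.exists_dist_le_of_unbounded {δ C M : ℝ} (h : FourPoint X δ) (hδ : 0 ≤ δ)
    {α β : ℕ → X} {o : X} (hα0 : α 0 = o) (hβ0 : β 0 = o)
    (hα : ∀ i, dist (α i) (α (i + 1)) ≤ M) (hβ : ∀ i, dist (β i) (β (i + 1)) ≤ M)
    (mα : ∀ j k, j ≤ k → gromovProduct (α j) o (α k) ≤ C)
    (mβ : ∀ j k, j ≤ k → gromovProduct (β j) o (β k) ≤ C)
    (hunb : ∀ B, ∃ i j, B < gromovProduct o (α i) (β j)) (n : ℕ) :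
    ∃ m, dist (α n) (β m) ≤ 4 * (C + δ) + M + 2 * δ := by
  have M0 : 0 ≤ M := dist_nonneg.trans (hα 0)
  have C0 : 0 ≤ C := (gromovProduct_nonneg _ _ _).trans (mα 0 0 le_rfl)
  have hlen : ∀ n : ℕ, dist o (α n) ≤ n * M := by
    intro n
    induction n with
    | zero => simp [hα0]
    | succ n ih =>
      have := dist_triangle o (α n) (α (n + 1))
      have := hα n
      push_cast; linarith
  -- As `dist o (α n) ≤ n * M`, a product this large means that the rays separate only after passing
  -- `α n`.
  obtain ⟨i, j, hij⟩ := hunb (n * M + δ)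
  have hni : n ≤ i := by
    by_contra hlt
    have h1 := gromovProduct_le_left o (α i) (β j)
    have h2 : (i : ℝ) * M ≤ n * M :=
      mul_le_mul_of_nonneg_right (by exact_mod_cast (not_le.mp hlt).le) M0
    linarith [hlen i]
  have h1 : gromovProduct (α n) o (β j) ≤ C + δ := by
    have e1 := gromovProduct_add o (α n) (β j)
    have e2 := gromovProduct_add o (α n) (α i)
    have e3 := mα n i hni
    rcases h.gromovProduct_le o (α n) (β j) (α i) with h | h
    · linarith
    · linarith [hlen n]
  set s := min (dist o (α n)) (dist o (β j)) with hs
  obtain ⟨m, -, hmj, hm⟩ := exists_nat_abs_sub_le (f := fun m => dist o (β m)) (M := M) (s := s)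
    (n := j) (a := 0) (fun i => by
      have := dist_dist_dist_le o (β (i + 1)) o (β i)
      rw [Real.dist_eq, dist_self, zero_add, dist_comm (β (i + 1))] at this
      exact this.trans (hβ i)) (Nat.zero_le _)
    (by simp only [hβ0, dist_self]; positivity) (min_le_right _ _)
  refine ⟨m, ?_⟩
  have h2 : |dist o (α n) - dist o (β m)| ≤ M + 2 * (C + δ) := by
    have h3 := abs_le.mp hm
    have h4 : dist o (α n) ≤ dist o (β j) + 2 * (C + δ) := by
      have := dist_comm (β j) (α n)
      unfold gromovProduct at h1
      linarith [dist_nonneg (x := β j) (y := α n)]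
    rw [abs_le]
    rcases min_cases (dist o (α n)) (dist o (β j)) with ⟨h, _⟩ | ⟨h, _⟩ <;> constructor <;>
      linarith
  have h5 := h.dist_le_of_position h1 ((mβ m j hmj).trans (by linarith)) h2
  linarith

/-- Orbits of independent hyperbolic elements diverge. -/
theorem AreIndependent.exists_gromovProduct_le {δ : ℝ} (hX : IsQuasiTree X) (h4 : FourPoint X δ)
    (hδ : 0 ≤ δ) {g₁ g₂ : G} (h₁ : IsHyperbolicElement X g₁) (h₂ : IsHyperbolicElement X g₂)
    (hind : AreIndependent X g₁ g₂) (x : X) :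
    ∃ C, ∀ i j : ℤ, gromovProduct x (g₁ ^ i • x) (g₂ ^ j • x) ≤ C := by
  obtain ⟨C₁, hC₁⟩ := h₁.exists_morseOrbit hX h4 x
  obtain ⟨C₂, hC₂⟩ := h₂.exists_morseOrbit hX h4 x
  obtain ⟨K₁, L₁, q₁⟩ := h₁.quasiGeodesic x
  obtain ⟨K₂, L₂, q₂⟩ := h₂.quasiGeodesic x
  have hstep : ∀ (g : G) (ε : ℤ), (ε = 1 ∨ ε = -1) → ∀ i : ℕ,
      dist (g ^ (ε * i) • x) (g ^ (ε * (i + 1 : ℕ)) • x) = dist x (g • x) := by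
    intro g ε hε i
    rw [dist_smul_zpow, show ε * ((i + 1 : ℕ) : ℤ) - ε * i = ε by push_cast; ring]
    rcases hε with rfl | rfl
    · simp
    · rw [zpow_neg_one, dist_smul_inv]
  have key : ∀ ε η : ℤ, (ε = 1 ∨ ε = -1) → (η = 1 ∨ η = -1) → ∃ C, ∀ i j : ℕ,
      gromovProduct x (g₁ ^ (ε * i) • x) (g₂ ^ (η * j) • x) ≤ C := by
    intro ε η hε hη
    -- If the products are unbounded, each ray stays in a bounded neighbourhood of the other, so
    -- their Hausdorff distance is finite.
    by_contra! hcon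
    have hcon' : ∀ C, ∃ j i : ℕ, C < gromovProduct x (g₂ ^ (η * j) • x) (g₁ ^ (ε * i) • x) := by
      intro C
      obtain ⟨i, j, hij⟩ := hcon C
      exact ⟨j, i, by rwa [gromovProduct_comm]⟩
    set C := max C₁ C₂
    set M := max (dist x (g₁ • x)) (dist x (g₂ • x))
    have a := h4.exists_dist_le_of_unbounded (C := C) (M := M) hδ (o := x)
      (α := fun i : ℕ => g₁ ^ (ε * i) • x) (β := fun i : ℕ => g₂ ^ (η * i) • x) (by simp) (by simp)
      (fun i => (hstep g₁ ε hε i).le.trans (le_max_left _ _))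
      (fun i => (hstep g₂ η hη i).le.trans (le_max_right _ _))
      (fun j k hjk => (hC₁.ray hε j k hjk).trans (le_max_left _ _))
      (fun j k hjk => (hC₂.ray hη j k hjk).trans (le_max_right _ _)) hcon
    have b := h4.exists_dist_le_of_unbounded (C := C) (M := M) hδ (o := x)
      (α := fun i : ℕ => g₂ ^ (η * i) • x) (β := fun i : ℕ => g₁ ^ (ε * i) • x) (by simp) (by simp)
      (fun i => (hstep g₂ η hη i).le.trans (le_max_right _ _))
      (fun i => (hstep g₁ ε hε i).le.trans (le_max_left _ _))
      (fun j k hjk => (hC₂.ray hη j k hjk).trans (le_max_right _ _))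
      (fun j k hjk => (hC₁.ray hε j k hjk).trans (le_max_left _ _)) hcon'
    have htop := hind (max K₁ K₂) (max L₁ L₂) _ _
      (isQuasiAxis_orbit (q₁.mono (le_max_left _ _) (le_max_left _ _)))
      (isQuasiAxis_orbit (q₂.mono (le_max_right _ _) (le_max_right _ _)))
      _ _ (isRayOf_orbit g₁ x hε) (isRayOf_orbit g₂ x hη)
    have hle := Metric.hausdorffEDist_le_of_mem_edist
      (r := ENNReal.ofReal (4 * (C + δ) + M + 2 * δ))
      (s := Set.range fun n : ℕ => g₁ ^ (ε * n) • x) (t := Set.range fun n : ℕ => g₂ ^ (η * n) • x)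
      (by
        rintro _ ⟨n, rfl⟩
        obtain ⟨m, hm⟩ := a n
        exact ⟨_, ⟨m, rfl⟩, by rw [edist_dist]; exact ENNReal.ofReal_le_ofReal hm⟩)
      (by
        rintro _ ⟨n, rfl⟩
        obtain ⟨m, hm⟩ := b n
        exact ⟨_, ⟨m, rfl⟩, by rw [edist_dist]; exact ENNReal.ofReal_le_ofReal hm⟩)
    rw [htop, top_le_iff] at hle
    exact ENNReal.ofReal_ne_top hle
  obtain ⟨c1, k1⟩ := key 1 1 (.inl rfl) (.inl rfl)
  obtain ⟨c2, k2⟩ := key 1 (-1) (.inl rfl) (.inr rfl)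
  obtain ⟨c3, k3⟩ := key (-1) 1 (.inr rfl) (.inl rfl)
  obtain ⟨c4, k4⟩ := key (-1) (-1) (.inr rfl) (.inr rfl)
  refine ⟨max (max c1 c2) (max c3 c4), fun i j => ?_⟩
  obtain ⟨m, rfl | rfl⟩ := i.eq_nat_or_neg <;> obtain ⟨n, rfl | rfl⟩ := j.eq_nat_or_neg
  · exact le_max_of_le_left (le_max_of_le_left (by simpa using k1 m n))
  · exact le_max_of_le_left (le_max_of_le_right (by simpa using k2 m n))
  · exact le_max_of_le_right (le_max_of_le_left (by simpa using k3 m n))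
  · exact le_max_of_le_right (le_max_of_le_right (by simpa using k4 m n))

end Orbits

end BestvinaFujiwara

namespace BestvinaFujiwara

/-! ### Overlaps of translates of inequivalent axes -/

section Overlap

variable {G : Type u} [Group G] {X : Type v} [MetricSpace X] [MulAction G X]

theorem FourPoint.position_mid {δ B C : ℝ} (h : FourPoint X δ) {x y v w m : X}
    (hv : gromovProduct v x y ≤ B) (hw : gromovProduct w x y ≤ B) (hvw : dist x v ≤ dist x w)
    (hm : gromovProduct m v w ≤ C) :
    dist x v + dist v m - (2 * C + 4 * B + 2 * δ) ≤ dist x m ∧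
      dist x m + dist m w - (2 * C + 4 * B + 2 * δ) ≤ dist x w := by
  have h1 := h.dist_add_le hv hw hvw hm
  have h2 := dist_triangle x w y
  have h3 := dist_triangle m w y
  have h4 := dist_triangle x m y
  have h5 := dist_triangle x v m
  constructor <;> linarith

theorem MorseOrbit.mono {C C' : ℝ} {g : G} {x : X} (h : MorseOrbit C g x) (hC : C ≤ C') :
    MorseOrbit C' g x := fun i j k hij hjk => (h i j k hij hjk).trans hC

variable [IsIsometricSMul G X]

theorem MorseOrbit.smul_npow {C : ℝ} {g : G} {x : X} (hC : MorseOrbit C g x) (h : G) {i j k : ℕ}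
    (hij : i ≤ j) (hjk : j ≤ k) :
    gromovProduct (h • g ^ j • x) (h • g ^ i • x) (h • g ^ k • x) ≤ C := by
  rw [gromovProduct_smul]
  simpa using hC i j k (by exact_mod_cast hij) (by exact_mod_cast hjk)

theorem dist_npow_le (g : G) (x : X) (n : ℕ) : dist x (g ^ n • x) ≤ n * dist x (g • x) := by
  induction n with
  | zero => simp
  | succ n ih =>
    have h1 := dist_triangle x (g ^ n • x) (g ^ (n + 1) • x)
    rw [pow_succ, dist_mul_smul] at h1
    push_cast
    rw [pow_succ]
    linarith

theorem dist_smul_npow_le (g h : G) (x : X) {i j : ℕ} (hij : i ≤ j) :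
    dist (h • g ^ i • x) (h • g ^ j • x) ≤ ((j : ℝ) - i) * dist x (g • x) := by
  obtain ⟨k, rfl⟩ := Nat.exists_eq_add_of_le hij
  rw [dist_smul, pow_add, dist_mul_smul]
  simpa using dist_npow_le g x k

theorem abs_position_sub_le (g h : G) (x x' : X) (i : ℕ) :
    |dist x' (h • g ^ (i + 1) • x) - dist x' (h • g ^ i • x)| ≤ dist x (g • x) := by
  have h1 := dist_dist_dist_le x' (h • g ^ (i + 1) • x) x' (h • g ^ i • x)
  rw [Real.dist_eq, dist_self, zero_add, dist_comm (h • g ^ (i + 1) • x), dist_smul, pow_succ,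
    dist_mul_smul] at h1
  rwa [pow_succ]

/-- Two segments of translates of the axes of inequivalent elements which are traversed in the
positive direction along a geodesic overlap in bounded length. -/
theorem exists_overlap_le {δ C : ℝ} (h4 : FourPoint X δ) (hδ : 0 ≤ δ) {g₁ g₂ : G}
    {x : X} (h₁ : IsHyperbolicElement X g₁) (h₂ : IsHyperbolicElement X g₂)
    (hC₁ : MorseOrbit C g₁ x) (hC₂ : MorseOrbit C g₂ x) (hne : ¬ AxisEquivalent X g₁ g₂) (B : ℝ) :
    ∃ L₀ : ℝ, ∀ (x' y' : X) (h h' : G) (n m : ℕ) (s t : ℝ),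
      gromovProduct (h • x) x' y' ≤ B → gromovProduct (h • g₁ ^ n • x) x' y' ≤ B →
      gromovProduct (h' • x) x' y' ≤ B → gromovProduct (h' • g₂ ^ m • x) x' y' ≤ B →
      dist x' (h • x) ≤ s → t ≤ dist x' (h • g₁ ^ n • x) →
      dist x' (h' • x) ≤ s → t ≤ dist x' (h' • g₂ ^ m • x) → t - s ≤ L₀ := by
  obtain ⟨K₁, L₁, q₁⟩ := h₁.quasiGeodesic x
  obtain ⟨K₂, L₂, q₂⟩ := h₂.quasiGeodesic x
  have C0 : 0 ≤ C := (gromovProduct_nonneg _ _ _).trans (hC₁ 0 0 0 le_rfl le_rfl)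
  by_contra! hcon
  apply hne
  set M := max (dist x (g₁ • x)) (dist x (g₂ • x)) with hM
  have M0 : 0 ≤ M := dist_nonneg.trans (le_max_left _ _)
  set B₁ := C + 2 * B + δ with hB₁
  set E := 2 * C + 4 * B₁ + 2 * δ with hE
  refine ⟨max K₁ K₂, max L₁ L₂, 2 * B₁ + (2 * M + E) + 2 * δ, _, _,
    isQuasiAxis_orbit (q₁.mono (le_max_left _ _) (le_max_left _ _)),
    isQuasiAxis_orbit (q₂.mono (le_max_right _ _) (le_max_right _ _)), fun T => ?_⟩
  -- Positions are attained up to `M` at each end and one power of `g₁` advances by at most `M`, so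
  -- an overlap this long contains at least `T` powers.
  obtain ⟨x', y', h, h', n, m, s, t, b1, b2, b3, b4, p1, p2, p3, p4, hlt⟩ :=
    hcon (2 * M + |T| * M)
  have B0 : 0 ≤ B := (gromovProduct_nonneg _ _ _).trans b1
  have TM : 0 ≤ |T| * M := by positivity
  set f : ℕ → ℝ := fun i => dist x' (h • g₁ ^ i • x) with hf
  set f' : ℕ → ℝ := fun i => dist x' (h' • g₂ ^ i • x) with hf'
  have fM : ∀ i, |f (i + 1) - f i| ≤ M := fun i =>
    (abs_position_sub_le g₁ h x x' i).trans (le_max_left _ _)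
  have fM' : ∀ i, |f' (i + 1) - f' i| ≤ M := fun i =>
    (abs_position_sub_le g₂ h' x x' i).trans (le_max_right _ _)
  have f0 : f 0 ≤ s := by simpa [hf] using p1
  have f0' : f' 0 ≤ s := by simpa [hf'] using p3
  have mid : ∀ r ≤ n, gromovProduct (h • g₁ ^ r • x) x' y' ≤ B₁ := fun r hr =>
    h4.gromovProduct_mid (v := h • g₁ ^ 0 • x) (by simpa using b1) b2
      (by change f 0 ≤ f n; linarith) (hC₁.smul_npow h (Nat.zero_le r) hr)
  have mid' : ∀ r ≤ m, gromovProduct (h' • g₂ ^ r • x) x' y' ≤ B₁ := fun r hr =>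
    h4.gromovProduct_mid (v := h' • g₂ ^ 0 • x) (by simpa using b3) b4
      (by change f' 0 ≤ f' m; linarith) (hC₂.smul_npow h' (Nat.zero_le r) hr)
  -- Indices at which the two segments pass the positions `s` and `t`. On the second one they come
  -- in this order, which is the orientation condition.
  obtain ⟨r₁, -, hr₁, ha₁⟩ := exists_nat_abs_sub_le fM (Nat.zero_le n) f0
    (show s ≤ f n by linarith)
  have ha₁' := abs_le.mp ha₁
  obtain ⟨r₂, hr₁₂, hr₂, ha₂⟩ := exists_nat_abs_sub_le fM hr₁ (show f r₁ ≤ t by linarith) p2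
  have ha₂' := abs_le.mp ha₂
  obtain ⟨s₁, -, hs₁, hb₁⟩ := exists_nat_abs_sub_le fM' (Nat.zero_le m) f0'
    (show s ≤ f' m by linarith)
  have hb₁' := abs_le.mp hb₁
  obtain ⟨s₂, hs₁₂, hs₂, hb₂⟩ := exists_nat_abs_sub_le fM' hs₁ (show f' s₁ ≤ t by linarith) p4
  have hb₂' := abs_le.mp hb₂
  have hlt₂ : s₁ < s₂ := by
    rcases hs₁₂.eq_or_lt with he | he
    · rw [he] at hb₁'; linarith
    · exact he
  have close : ∀ r ≤ n, ∀ q ≤ m, |f r - f' q| ≤ 2 * M + E →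
      dist (h • g₁ ^ r • x) (h' • g₂ ^ q • x) ≤ 2 * B₁ + (2 * M + E) + 2 * δ := fun r hr q hq hrq =>
    h4.dist_le_of_position (mid r hr) (mid' q hq) hrq
  have E0 : 0 ≤ E := by positivity
  have trans : ∀ (k : ℕ) (q : ℕ), dist ((h'⁻¹ * h * g₁ ^ r₁) • g₁ ^ k • x) (g₂ ^ q • x) =
      dist (h • g₁ ^ (r₁ + k) • x) (h' • g₂ ^ q • x) := by
    intro k q
    rw [← dist_smul h']
    simp only [mul_smul, pow_add, smul_inv_smul]
  refine ⟨0, ((r₂ - r₁ : ℕ) : ℝ), ?_, by positivity, h'⁻¹ * h * g₁ ^ r₁, ?_, s₁, s₂,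
    by exact_mod_cast hlt₂, ?_, ?_⟩
  · have h1 : f r₂ - f r₁ ≤ ((r₂ : ℝ) - r₁) * M := by
      have e1 := dist_smul_npow_le g₁ h x hr₁₂
      have e2 := dist_triangle x' (h • g₁ ^ r₁ • x) (h • g₁ ^ r₂ • x)
      have e3 : ((r₂ : ℝ) - r₁) * dist x (g₁ • x) ≤ ((r₂ : ℝ) - r₁) * M :=
        mul_le_mul_of_nonneg_left (le_max_left _ _) (sub_nonneg.mpr (by exact_mod_cast hr₁₂))
      simp only [hf]; linarith
    rw [Nat.cast_sub hr₁₂, sub_zero]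
    by_contra! hT
    have h2 : ((r₂ : ℝ) - r₁) * M ≤ |T| * M :=
      mul_le_mul_of_nonneg_right (hT.le.trans (le_abs_self T)) M0
    linarith
  · intro r ⟨hr0, hr1⟩
    obtain ⟨k, hk⟩ : ∃ k : ℕ, ⌊r⌋ = k := ⟨⌊r⌋.toNat, by
      rw [Int.toNat_of_nonneg (Int.floor_nonneg.mpr hr0)]⟩
    have hk2 : k ≤ r₂ - r₁ := by
      have h1 : (⌊r⌋ : ℝ) ≤ ((r₂ - r₁ : ℕ) : ℝ) := (Int.floor_le r).trans hr1
      rw [hk] at h1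
      exact_mod_cast h1
    have hk3 : r₁ + k ≤ r₂ := by omega
    obtain ⟨u1, u2⟩ := h4.position_mid (mid r₁ hr₁) (mid r₂ hr₂)
      (by change f r₁ ≤ f r₂; linarith) (hC₁.smul_npow h (show r₁ ≤ r₁ + k by omega) hk3)
    have u3 : f r₁ - E ≤ f (r₁ + k) := by
      simp only [hf]
      linarith [dist_nonneg (x := h • g₁ ^ r₁ • x) (y := h • g₁ ^ (r₁ + k) • x)]
    have u4 : f (r₁ + k) ≤ f r₂ + E := by
      simp only [hf]
      linarith [dist_nonneg (x := h • g₁ ^ (r₁ + k) • x) (y := h • g₁ ^ r₂ • x)]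
    -- Positions are only coarsely monotone along an orbit and may leave `[s, t]` slightly, hence
    -- the clamping.
    obtain ⟨q, -, hq, hqs⟩ := exists_nat_abs_sub_le fM' (Nat.zero_le m)
      (s := max s (min t (f (r₁ + k)))) (f0'.trans (le_max_left _ _))
      (max_le (by linarith) ((min_le_left _ _).trans p4))
    refine ⟨q, ?_⟩
    simp only [hk, zpow_natCast, Int.floor_natCast]
    rw [trans]
    apply close _ (by omega) _ hq
    have hqs' := abs_le.mp hqs
    rw [abs_le]
    rcases max_cases s (min t (f (r₁ + k))) with ⟨c1, c1'⟩ | ⟨c1, c1'⟩ <;>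
      rcases min_cases t (f (r₁ + k)) with ⟨c2, c2'⟩ | ⟨c2, c2'⟩ <;>
      constructor <;> linarith
  · have := trans 0 s₁
    simp only [pow_zero, one_smul, add_zero] at this
    simp only [Int.floor_zero, zpow_zero, one_smul, Int.floor_natCast, zpow_natCast]
    rw [this]
    apply close _ hr₁ _ hs₁
    rw [abs_le]; constructor <;> linarith
  · simp only [Int.floor_natCast, zpow_natCast]
    rw [trans, show r₁ + (r₂ - r₁) = r₂ by omega]
    apply close _ hr₂ _ hs₂
    rw [abs_le]; constructor <;> linarith

/-- The version of `exists_overlap_le` for segments traversed in the negative direction. -/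
theorem exists_overlap_le_of_reversed {δ C : ℝ} (h4 : FourPoint X δ) (hδ : 0 ≤ δ) {g₁ g₂ : G}
    {x : X} (h₁ : IsHyperbolicElement X g₁) (h₂ : IsHyperbolicElement X g₂)
    (hC₁ : MorseOrbit C g₁ x) (hC₂ : MorseOrbit C g₂ x) (hne : ¬ AxisEquivalent X g₁ g₂) (B : ℝ) :
    ∃ L₀ : ℝ, ∀ (x' y' : X) (h h' : G) (n m : ℕ) (s t : ℝ),
      gromovProduct (h • x) x' y' ≤ B → gromovProduct (h • g₁ ^ n • x) x' y' ≤ B →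
      gromovProduct (h' • x) x' y' ≤ B → gromovProduct (h' • g₂ ^ m • x) x' y' ≤ B →
      t ≤ dist x' (h • x) → dist x' (h • g₁ ^ n • x) ≤ s →
      t ≤ dist x' (h' • x) → dist x' (h' • g₂ ^ m • x) ≤ s → t - s ≤ L₀ := by
  obtain ⟨L₀, H⟩ := exists_overlap_le h4 hδ h₁ h₂ hC₁ hC₂ hne B
  refine ⟨L₀ + 2 * B, fun x' y' h h' n m s t b1 b2 b3 b4 p1 p2 p3 p4 => ?_⟩
  have pos : ∀ z, gromovProduct z x' y' ≤ B →
      dist x' y' - dist x' z ≤ dist y' z ∧ dist y' z ≤ dist x' y' - dist x' z + 2 * B := by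
    intro z hz
    have := dist_triangle x' z y'
    have := dist_comm z y'
    unfold gromovProduct at hz
    constructor <;> linarith
  -- Seen from `y'` the segments are traversed positively; positions are reflected up to an error `2
  -- * B`.
  have := H y' x' h h' n m (dist x' y' - t + 2 * B) (dist x' y' - s)
    (by rwa [gromovProduct_comm]) (by rwa [gromovProduct_comm]) (by rwa [gromovProduct_comm])
    (by rwa [gromovProduct_comm]) (by linarith [(pos _ b1).2]) (by linarith [(pos _ b2).1])
    (by linarith [(pos _ b3).2]) (by linarith [(pos _ b4).1])
  linarith

end Overlap

end BestvinaFujiwara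

namespace BestvinaFujiwara

/-! ### Discounted distances and their quasimorphisms -/

section Discount

variable {G : Type u} [Group G] {X : Type v} [MetricSpace X] [MulAction G X]

/-- `DiscountChain G p q W x y c`: there is a chain of total cost `c` from `x` to `y`, where moves
cost their length and jumps along a translate of `(p, q)` get a discount `W`. -/
inductive DiscountChain (G : Type u) [Group G] {X : Type v} [MetricSpace X] [MulAction G X]
    (p q : X) (W : ℝ) (x : X) : X → ℝ → Prop
  | nil : DiscountChain G p q W x x 0
  | move {y : X} {c : ℝ} (z : X) (h : DiscountChain G p q W x y c) :
      DiscountChain G p q W x z (c + dist y z)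
  | jump {c : ℝ} (g : G) (h : DiscountChain G p q W x (g • p) c) :
      DiscountChain G p q W x (g • q) (c + (dist p q - W))

variable {p q : X} {W : ℝ}

namespace DiscountChain

theorem of_dist (x y : X) : DiscountChain G p q W x y (dist x y) := by
  simpa using (nil (G := G) (p := p) (q := q) (W := W) (x := x)).move y

theorem trans {x y z : X} {c d : ℝ} (h : DiscountChain G p q W x y c)
    (h' : DiscountChain G p q W y z d) : DiscountChain G p q W x z (c + d) := by
  induction h' with
  | nil => simpa using h
  | move z _ ih => rw [← add_assoc]; exact ih.move z
  | jump g _ ih => rw [← add_assoc]; exact ih.jump g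

/-- Jumps which do not increase a `1`-Lipschitz function enough do not pay. -/
theorem sub_le {φ : X → ℝ} (h1 : ∀ x y, φ x - φ y ≤ dist x y)
    (h2 : ∀ g : G, φ (g • p) - φ (g • q) ≤ dist p q - W) {x y : X} {c : ℝ}
    (h : DiscountChain G p q W x y c) : φ x - φ y ≤ c := by
  induction h with
  | nil => simp
  | @move y c z _ ih => linarith [h1 y z]
  | jump g _ ih => linarith [h2 g]

theorem nonneg (hW : W ≤ dist p q) {x y : X} {c : ℝ} (h : DiscountChain G p q W x y c) :
    0 ≤ c := by
  simpa using h.sub_le (φ := fun _ => 0) (by simp) (by simpa using hW)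

variable [IsIsometricSMul G X]

theorem smul (g : G) {x y : X} {c : ℝ} (h : DiscountChain G p q W x y c) :
    DiscountChain G p q W (g • x) (g • y) c := by
  induction h with
  | nil => exact nil
  | @move y c z _ ih => rw [← dist_smul g]; exact ih.move _
  | jump k _ ih =>
    rw [smul_smul] at ih ⊢
    exact ih.jump _

/-- A chain follows a path at each point of which it can be cut. -/
theorem exists_path (hX : IsGeodesicSpace X) (hW : 0 ≤ W) {x y : X} {c : ℝ}
    (h : DiscountChain G p q W x y c) : ∃ γ : Path x y, ∀ t, ∃ c₁ c₂,
      DiscountChain G p q W x (γ t) c₁ ∧ DiscountChain G p q W (γ t) y c₂ ∧ c₁ + c₂ ≤ c + W := by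
  induction h with
  | nil => exact ⟨Path.refl _, fun t => ⟨0, 0, nil, nil, by linarith⟩⟩
  | @move y c z h ih =>
    obtain ⟨γ, hγ⟩ := ih
    obtain ⟨η, hη⟩ := hX.exists_path y z
    refine ⟨γ.trans η, fun t => ?_⟩
    have : (γ.trans η) t ∈ Set.range γ ∪ Set.range η := by
      rw [← Path.trans_range]; exact ⟨t, rfl⟩
    rcases this with ⟨s, hs⟩ | ⟨s, hs⟩
    · obtain ⟨c₁, c₂, k1, k2, k3⟩ := hγ s
      rw [← hs]
      exact ⟨c₁, _, k1, k2.move z, by linarith⟩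
    · rw [← hs]
      exact ⟨_, _, h.move (η s), of_dist _ _, by linarith [hη s]⟩
  | @jump c g h ih =>
    obtain ⟨γ, hγ⟩ := ih
    obtain ⟨η, hη⟩ := hX.exists_path (g • p) (g • q)
    refine ⟨γ.trans η, fun t => ?_⟩
    have : (γ.trans η) t ∈ Set.range γ ∪ Set.range η := by
      rw [← Path.trans_range]; exact ⟨t, rfl⟩
    rcases this with ⟨s, hs⟩ | ⟨s, hs⟩
    · obtain ⟨c₁, c₂, k1, k2, k3⟩ := hγ s
      rw [← hs]
      exact ⟨c₁, _, k1, k2.jump g, by linarith⟩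
    -- Stopping inside a jump forfeits its discount; this is the loss `W`.
    · rw [← hs]
      have h1 := hη s
      rw [dist_smul] at h1
      exact ⟨_, _, h.move (η s), of_dist _ _, by linarith⟩

end DiscountChain

variable (G p q W) in
/-- The distance with a discount `W` for jumps along translates of `(p, q)`. -/
noncomputable def discountDist (x y : X) : ℝ := sInf {c | DiscountChain G p q W x y c}

theorem discountDist_le (hW : W ≤ dist p q) {x y : X} {c : ℝ} (h : DiscountChain G p q W x y c) :
    discountDist G p q W x y ≤ c :=
  csInf_le ⟨0, fun _ hc => DiscountChain.nonneg hW hc⟩ h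

theorem le_discountDist {x y : X} {b : ℝ} (h : ∀ c, DiscountChain G p q W x y c → b ≤ c) :
    b ≤ discountDist G p q W x y :=
  le_csInf ⟨_, DiscountChain.of_dist x y⟩ h

theorem exists_chain_lt {x y : X} {b : ℝ} (h : discountDist G p q W x y < b) :
    ∃ c < b, DiscountChain G p q W x y c := by
  obtain ⟨c, hc, hb⟩ := exists_lt_of_csInf_lt ⟨_, DiscountChain.of_dist x y⟩ h
  exact ⟨c, hb, hc⟩

theorem discountDist_nonneg (hW : W ≤ dist p q) (x y : X) : 0 ≤ discountDist G p q W x y :=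
  le_discountDist fun _ => DiscountChain.nonneg hW

theorem discountDist_le_dist (hW : W ≤ dist p q) (x y : X) :
    discountDist G p q W x y ≤ dist x y :=
  discountDist_le hW (DiscountChain.of_dist x y)

theorem discountDist_triangle (hW : W ≤ dist p q) (x y z : X) :
    discountDist G p q W x z ≤ discountDist G p q W x y + discountDist G p q W y z := by
  refine le_of_forall_pos_le_add fun ε hε => ?_
  obtain ⟨c, hc, h1⟩ := exists_chain_lt (show discountDist G p q W x y < _ + ε / 2 from
    lt_add_of_pos_right _ (half_pos hε))
  obtain ⟨d, hd, h2⟩ := exists_chain_lt (show discountDist G p q W y z < _ + ε / 2 from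
    lt_add_of_pos_right _ (half_pos hε))
  linarith [discountDist_le hW (h1.trans h2)]

theorem discountDist_pow_le (hW : W ≤ dist p q) {x : X} {a : G} [IsIsometricSMul G X] {c : ℝ}
    (h : DiscountChain G p q W x (a • x) c) (n : ℕ) :
    discountDist G p q W x (a ^ n • x) ≤ n * c := by
  refine discountDist_le hW ?_
  induction n with
  | zero => simpa using DiscountChain.nil
  | succ n ih =>
    have := ih.trans (h.smul (a ^ n))
    rw [smul_smul, ← pow_succ] at this
    convert this using 1
    push_cast; ring

/-- The antisymmetrization of the discounted distance. -/
noncomputable def discountCocycle (G : Type u) [Group G] {X : Type v} [MetricSpace X]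
    [MulAction G X] (p q : X) (W : ℝ) (x y : X) : ℝ :=
  discountDist G p q W y x - discountDist G p q W x y

theorem discountCocycle_neg (x y : X) :
    discountCocycle G p q W y x = -discountCocycle G p q W x y := by
  simp [discountCocycle]

theorem abs_discountCocycle_le (hW : W ≤ dist p q) (x y : X) :
    |discountCocycle G p q W x y| ≤ dist x y := by
  have h1 := discountDist_nonneg (G := G) hW x y
  have h2 := discountDist_nonneg (G := G) hW y x
  have h3 := discountDist_le_dist (G := G) hW x y
  have h4 := discountDist_le_dist (G := G) hW y x
  rw [dist_comm] at h4
  rw [discountCocycle, abs_le]; constructor <;> linarith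

variable [IsIsometricSMul G X]

theorem discountDist_smul (g : G) (x y : X) :
    discountDist G p q W (g • x) (g • y) = discountDist G p q W x y := by
  have : ∀ c, DiscountChain G p q W (g • x) (g • y) c ↔ DiscountChain G p q W x y c := fun c =>
    ⟨fun h => by simpa using h.smul g⁻¹, fun h => h.smul g⟩
  simp only [discountDist, this]

theorem discountCocycle_smul (g : G) (x y : X) :
    discountCocycle G p q W (g • x) (g • y) = discountCocycle G p q W x y := by
  simp only [discountCocycle, discountDist_smul]

/-- In a quasi-tree discounted distances are almost additive along geodesics. -/
theorem exists_discountDist_add_le {δ : ℝ} (hX : IsQuasiTree X) (h4 : FourPoint X δ) (hW0 : 0 ≤ W)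
    (hW : W ≤ dist p q) (e : ℝ) : ∃ K, ∀ x y m : X, gromovProduct m x y ≤ e →
      discountDist G p q W x m + discountDist G p q W m y ≤ discountDist G p q W x y + K := by
  obtain ⟨R, -, HR⟩ := hX.exists_bottleneck h4 e
  -- `W` pays for cutting the chain near the bottleneck, `2 * R` for the detour to `m` and back.
  refine ⟨W + 2 * R, fun x y m hm => le_of_forall_pos_le_add fun ε hε => ?_⟩
  obtain ⟨c, hc, h⟩ := exists_chain_lt (show discountDist G p q W x y < _ + ε from
    lt_add_of_pos_right _ hε)
  obtain ⟨γ, hγ⟩ := h.exists_path hX.geodesic hW0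
  obtain ⟨t, ht⟩ := HR x y m hm γ
  obtain ⟨c₁, c₂, h1, h2, h3⟩ := hγ t
  have h5 := discountDist_le hW (h1.move m)
  have h6 := discountDist_le hW ((DiscountChain.of_dist m (γ t)).trans h2)
  rw [dist_comm] at h6
  linarith

/-- Cutting each side at the centre of the triangle costs at most `K`, and the six halves cancel in
pairs by antisymmetry. -/
theorem exists_discountCocycle_bound {δ : ℝ} (hX : IsQuasiTree X) (h4 : FourPoint X δ)
    (hδ : 0 ≤ δ) (hW0 : 0 ≤ W) (hW : W ≤ dist p q) : ∃ K, ∀ x y z : X,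
      |discountCocycle G p q W x y + discountCocycle G p q W y z + discountCocycle G p q W z x|
        ≤ K := by
  obtain ⟨K, hK⟩ := exists_discountDist_add_le (G := G) hX h4 hW0 hW δ
  have key : ∀ x y m : X, gromovProduct m x y ≤ δ →
      |discountCocycle G p q W x y - discountCocycle G p q W x m - discountCocycle G p q W m y|
        ≤ K := by
    intro x y m hm
    have h1 := hK x y m hm
    have h2 := hK y x m (by rwa [gromovProduct_comm])
    have h3 := discountDist_triangle (G := G) hW x m y
    have h5 := discountDist_triangle (G := G) hW y m x
    simp only [discountCocycle]
    rw [abs_le]; constructor <;> linarith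
  refine ⟨3 * K, fun x y z => ?_⟩
  obtain ⟨m, m1, m2, m3⟩ := h4.exists_center hδ hX.geodesic x y z
  have k1 := abs_le.mp (key x y m m1)
  have k2 := abs_le.mp (key y z m m2)
  have k3 := abs_le.mp (key z x m m3)
  rw [discountCocycle_neg x m] at k3
  rw [discountCocycle_neg y m] at k1
  rw [discountCocycle_neg z m] at k2
  rw [abs_le]; constructor <;> linarith

end Discount

/-! ### Homogenization of quasimorphisms -/

section Homogenization

variable {G : Type u} [Group G]

theorem abs_npow_sub_le {f : G → ℝ} {D : ℝ} (hD : ∀ a b, |f a + f b - f (a * b)| ≤ D) (g : G)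
    (n : ℕ) : |f (g ^ n) - n * f g| ≤ (n + 1) * D := by
  have D0 : 0 ≤ D := (abs_nonneg _).trans (hD 1 1)
  induction n with
  | zero =>
    have := hD 1 1
    simpa using this
  | succ n ih =>
    have h1 := abs_le.mp (hD (g ^ n) g)
    have h2 := abs_le.mp ih
    rw [pow_succ, abs_le]
    push_cast
    constructor <;> linarith

/-- Every quasimorphism is at bounded distance from a pseudocharacter. -/
theorem exists_homogenization {f : G → ℝ} {D : ℝ} (hD : ∀ a b, |f a + f b - f (a * b)| ≤ D) :
    ∃ h : G → ℝ, IsPseudocharacter h ∧ (∀ g, |h g - f g| ≤ D) ∧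
      ∀ g, Tendsto (fun n : ℕ => f (g ^ n) / n) atTop (nhds (h g)) := by
  have D0 : 0 ≤ D := (abs_nonneg _).trans (hD 1 1)
  have hlim : ∀ g, ∃ l, Tendsto (fun n : ℕ => f (g ^ n) / n) atTop (nhds l) := by
    intro g
    -- The constant `D` turns the quasimorphism inequality into subadditivity, so that Fekete's
    -- lemma applies.
    have hsub : Subadditive fun n : ℕ => f (g ^ n) + D := by
      intro m n
      have := abs_le.mp (hD (g ^ m) (g ^ n))
      simp only [pow_add]; linarith
    have hbdd : BddBelow (Set.range fun n : ℕ => (f (g ^ n) + D) / n) := by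
      refine ⟨-|f g| - D, ?_⟩
      rintro _ ⟨n, rfl⟩
      rcases Nat.eq_zero_or_pos n with rfl | hn
      · simp; linarith [abs_nonneg (f g)]
      · have hn' : (0 : ℝ) < n := by exact_mod_cast hn
        simp only
        rw [le_div_iff₀ hn']
        have h1 := abs_le.mp (abs_npow_sub_le hD g n)
        have h2 := mul_le_mul_of_nonneg_left (neg_abs_le (f g)) hn'.le
        linarith
    have h1 := hsub.tendsto_lim hbdd
    have h2 : Tendsto (fun n : ℕ => D / (n : ℝ)) atTop (nhds 0) :=
      tendsto_const_div_atTop_nhds_zero_nat D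
    refine ⟨hsub.lim, ?_⟩
    have h3 := h1.sub h2
    simp only [sub_zero] at h3
    refine h3.congr fun n => ?_
    rw [← sub_div]; ring_nf
  choose h hh using hlim
  have hclose : ∀ g, |h g - f g| ≤ D := by
    intro g
    have h1 : Tendsto (fun n : ℕ => |f (g ^ n) / n - f g|) atTop (nhds |h g - f g|) :=
      ((hh g).sub_const _).abs
    have h2 : Tendsto (fun n : ℕ => D + D / (n : ℝ)) atTop (nhds (D + 0)) :=
      tendsto_const_nhds.add (tendsto_const_div_atTop_nhds_zero_nat D)
    rw [add_zero] at h2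
    refine le_of_tendsto_of_tendsto h1 h2 ?_
    filter_upwards [eventually_gt_atTop 0] with n hn
    have hn' : (0 : ℝ) < n := by exact_mod_cast hn
    have h3 := abs_npow_sub_le hD g n
    have h4 : f (g ^ n) / n - f g = (f (g ^ n) - n * f g) / n := by field_simp
    have h5 : D + D / n = ((n + 1) * D) / n := by field_simp
    rw [h4, h5, abs_div, Nat.abs_cast]
    gcongr
  have hnat : ∀ g (k : ℕ), h (g ^ k) = k * h g := by
    intro g k
    rcases Nat.eq_zero_or_pos k with rfl | hk
    · have h1 := hh (1 : G)
      simp only [one_pow] at h1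
      have h2 : Tendsto (fun n : ℕ => f 1 / (n : ℝ)) atTop (nhds 0) :=
        tendsto_const_div_atTop_nhds_zero_nat _
      simp [tendsto_nhds_unique h1 h2]
    · have hk' : (k : ℝ) ≠ 0 := by positivity
      have h1 : Tendsto (fun n : ℕ => k * n) atTop atTop :=
        tendsto_id.const_mul_atTop' hk
      have h2 := ((hh g).comp h1).const_mul (k : ℝ)
      refine tendsto_nhds_unique (hh (g ^ k)) (h2.congr fun n => ?_)
      simp only [Function.comp]
      rw [← pow_mul]; push_cast
      rcases Nat.eq_zero_or_pos n with rfl | hn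
      · simp
      · have hn' : (n : ℝ) ≠ 0 := by positivity
        field_simp
  have hquasi : ∀ a b, |h a + h b - h (a * b)| ≤ 4 * D := by
    intro a b
    have h1 := abs_le.mp (hclose a)
    have h2 := abs_le.mp (hclose b)
    have h3 := abs_le.mp (hclose (a * b))
    have h4 := abs_le.mp (hD a b)
    rw [abs_le]; constructor <;> linarith
  have hone : h 1 = 0 := by simpa using hnat 1 0
  have hinv : ∀ g, h g⁻¹ = -h g := by
    intro g
    by_contra hne
    have hpos : 0 < |h g + h g⁻¹| := abs_pos.mpr fun h0 => hne (by linarith)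
    obtain ⟨n, hn⟩ := exists_nat_gt (4 * D / |h g + h g⁻¹|)
    rw [div_lt_iff₀ hpos] at hn
    have h1 := hquasi (g ^ n) (g⁻¹ ^ n)
    rw [hnat, hnat, inv_pow, mul_inv_cancel, hone, sub_zero, ← mul_add, abs_mul, Nat.abs_cast] at h1
    linarith
  refine ⟨h, ⟨fun a n => ?_, 4 * D, hquasi⟩, hclose, hh⟩
  obtain ⟨m, rfl | rfl⟩ := n.eq_nat_or_neg
  · simpa using hnat a m
  · simp [hinv, hnat]

theorem IsPseudocharacter.map_npow {f : G → ℝ} (hf : IsPseudocharacter f) (a : G) (n : ℕ) :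
    f (a ^ n) = n * f a := by simpa using hf.map_zpow a n

theorem IsPseudocharacter.map_inv {f : G → ℝ} (hf : IsPseudocharacter f) (a : G) :
    f a⁻¹ = -f a := by simpa using hf.map_zpow a (-1)

/-- Conjugating `a ^ n` changes the value by an amount bounded independently of `n`, whereas a
difference at `a` would be multiplied by `n`. -/
theorem IsPseudocharacter.map_conj {f : G → ℝ} (hf : IsPseudocharacter f) (a b : G) :
    f (b⁻¹ * a * b) = f a := by
  obtain ⟨C, hC⟩ := hf.bounded
  by_contra hne
  have hpos : 0 < |f (b⁻¹ * a * b) - f a| := abs_pos.mpr (sub_ne_zero.mpr hne)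
  obtain ⟨n, hn⟩ := exists_nat_gt (2 * C / |f (b⁻¹ * a * b) - f a|)
  rw [div_lt_iff₀ hpos] at hn
  have h1 := abs_le.mp (hC (b⁻¹ * a ^ n) b)
  have h2 := abs_le.mp (hC b⁻¹ (a ^ n))
  have h3 : b⁻¹ * a ^ n * b = (b⁻¹ * a * b) ^ n := by
    have := conj_pow (a := b⁻¹) (b := a) (i := n)
    rw [inv_inv] at this
    exact this.symm
  rw [h3, hf.map_npow] at h1
  rw [hf.map_inv, hf.map_npow] at h2
  have h5 : |(n : ℝ) * (f (b⁻¹ * a * b) - f a)| ≤ 2 * C := by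
    rw [abs_le]; constructor <;> linarith
  rw [abs_mul, Nat.abs_cast] at h5
  linarith

end Homogenization

end BestvinaFujiwara

namespace BestvinaFujiwara

/-! ### Ends of pseudocharacters -/

section Words

variable {G : Type u} [Group G] {S : Set G}

theorem wordProd_cons (s : Letter S) (d : List (Letter S)) :
    wordProd (s :: d) = s * wordProd d := by simp [wordProd]

theorem wordProd_concat (s : Letter S) (d : List (Letter S)) :
    wordProd (d ++ [s]) = wordProd d * s := by simp [wordProd]

theorem prefixProd_zero (w : ℕ → Letter S) : prefixProd w 0 = 1 := by
  simp [prefixProd, wordProd]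

theorem prefixProd_succ (w : ℕ → Letter S) (n : ℕ) :
    prefixProd w (n + 1) = prefixProd w n * w n := by
  simp [prefixProd, wordProd, List.range_succ]

theorem exists_word (hgen : Subgroup.closure S = ⊤) (a : G) :
    ∃ l : List (Letter S), wordProd l = a := by
  obtain ⟨l, hl, rfl⟩ := Submonoid.exists_list_of_mem_closure
    (show a ∈ Submonoid.closure (S ∪ S⁻¹) by
      rw [← Subgroup.closure_toSubmonoid, hgen]; exact Subgroup.mem_top a)
  exact ⟨l.attach.map fun y => ⟨y.1, hl _ y.2⟩, by simp [wordProd, Function.comp_def]⟩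

theorem prefixProd_periodic (l : List (Letter S)) (hl : 0 < l.length) (i r : ℕ)
    (hr : r ≤ l.length) :
    prefixProd (fun n => l[n % l.length]'(Nat.mod_lt _ hl)) (l.length * i + r) =
      wordProd l ^ i * wordProd (l.take r) := by
  have A : ∀ i, prefixProd (fun n => l[n % l.length]'(Nat.mod_lt _ hl)) (l.length * i) =
      wordProd l ^ i → ∀ r ≤ l.length,
      prefixProd (fun n => l[n % l.length]'(Nat.mod_lt _ hl)) (l.length * i + r) =
        wordProd l ^ i * wordProd (l.take r) := by
    intro i hi r
    induction r with
    | zero => intro _; simpa [wordProd] using hi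
    | succ r ih =>
      intro hr
      have hlt : r < l.length := hr
      rw [← add_assoc, prefixProd_succ, ih hlt.le, List.take_succ_eq_append_getElem hlt,
        wordProd_concat, mul_assoc]
      simp [Nat.mod_eq_of_lt hlt]
  refine A i ?_ r hr
  clear hr r
  induction i with
  | zero => simp [prefixProd_zero]
  | succ i ih =>
    have := A i ih l.length le_rfl
    rw [List.take_length, ← pow_succ] at this
    rwa [Nat.mul_succ]

theorem wordSign_eq_one {f : G → ℝ} {w : ℕ → Letter S}
    (h : Tendsto (fun n => f (prefixProd w n)) atTop atTop) : wordSign f w = 1 := if_pos h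

theorem wordSign_eq_neg_one {f : G → ℝ} {w : ℕ → Letter S}
    (h : Tendsto (fun n => f (prefixProd w n)) atTop atBot) : wordSign f w = -1 := by
  rw [wordSign, if_neg (h.not_tendsto disjoint_atBot_atTop), if_pos h]

theorem exists_lt_abs_prefix {f : G → ℝ} {w : ℕ → Letter S}
    (h : wordSign f w = 1 ∨ wordSign f w = -1) (B : ℝ) :
    ∃ N, ∀ n, N ≤ n → B < |f (prefixProd w n)| := by
  have : Tendsto (fun n => |f (prefixProd w n)|) atTop atTop := by
    unfold wordSign at h
    split_ifs at h with h1 h2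
    · exact tendsto_abs_atTop_atTop.comp h1
    · exact tendsto_abs_atBot_atTop.comp h2
    · simp at h
  exact eventually_atTop.mp (this.eventually_gt_atTop B)

/-- The word obtained by repeating a word for `a`. -/
theorem IsPseudocharacter.exists_periodic_word {f : G → ℝ} (hf : IsPseudocharacter f)
    (hgen : Subgroup.closure S = ⊤) {a : G} (ha : f a ≠ 0) :
    ∃ w : ℕ → Letter S, (0 < f a → wordSign f w = 1) ∧ (f a < 0 → wordSign f w = -1) ∧
      ∃ L, 0 < L ∧ ∀ i, prefixProd w (L * i) = a ^ i := by
  obtain ⟨l, rfl⟩ := exists_word hgen a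
  have hl : 0 < l.length := by
    rcases Nat.eq_zero_or_pos l.length with h | h
    · refine absurd ?_ ha
      rw [List.length_eq_zero_iff.mp h]
      simpa [wordProd] using hf.map_npow 1 0
    · exact h
  obtain ⟨C, hC⟩ := hf.bounded
  set w : ℕ → Letter S := fun n => l[n % l.length]'(Nat.mod_lt _ hl) with hw
  have hper := prefixProd_periodic l hl
  -- Every prefix is a power of the period times a prefix of `l`; `K` controls the latter factor.
  obtain ⟨K, hK⟩ := ((Set.finite_Iic l.length).image fun r => |f (wordProd (l.take r))|).bddAbove
  have hclose : ∀ n, |f (prefixProd w n) - (n / l.length : ℕ) * f (wordProd l)| ≤ C + K := by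
    intro n
    have h1 := hper (n / l.length) (n % l.length) (Nat.mod_lt _ hl).le
    rw [Nat.div_add_mod] at h1
    rw [hw, h1]
    have h2 := abs_le.mp (hC (wordProd l ^ (n / l.length)) (wordProd (l.take (n % l.length))))
    have h3 := abs_le.mp (hK ⟨n % l.length, (Nat.mod_lt _ hl).le, rfl⟩)
    rw [hf.map_npow] at h2
    rw [abs_le]; constructor <;> linarith
  have hdiv : Tendsto (fun n : ℕ => ((n / l.length : ℕ) : ℝ)) atTop atTop :=
    tendsto_natCast_atTop_atTop.comp (Nat.tendsto_div_const_atTop hl.ne')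
  refine ⟨w, fun hpos => wordSign_eq_one ?_, fun hneg => wordSign_eq_neg_one ?_, l.length, hl,
    fun i => by simpa [wordProd] using hper i 0 (Nat.zero_le _)⟩
  · refine tendsto_atTop_mono (fun n => ?_)
      (tendsto_atTop_add_const_right _ (-(C + K)) (hdiv.atTop_mul_const hpos))
    linarith [abs_le.mp (hclose n)]
  · refine tendsto_atBot_mono (fun n => ?_)
      (tendsto_atBot_add_const_right _ (C + K) (hdiv.atTop_mul_const_of_neg hneg))
    linarith [abs_le.mp (hclose n)]

end Words

/-! ### Ends of words and complements of balls -/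

section Ends

variable {G : Type u} [Group G] {S : Set G} {X : Type v} [MetricSpace X] [MulAction G X]

/-- The prefixes of the words are eventually joined far away from the base point. -/
def FarJoined (x : X) (w v : ℕ → Letter S) : Prop :=
  ∀ R : ℝ, ∃ N, ∀ p q, N ≤ p → N ≤ q →
    JoinedIn {z | R < dist x z} (prefixProd w p • x) (prefixProd v q • x)

theorem FarJoined.symm {x : X} {w v : ℕ → Letter S} (h : FarJoined x w v) : FarJoined x v w := by
  intro R
  obtain ⟨N, hN⟩ := h R
  exact ⟨N, fun p q hp hq => (hN q p hq hp).symm⟩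

theorem FarJoined.trans {x : X} {w v u : ℕ → Letter S} (h : FarJoined x w v)
    (h' : FarJoined x v u) : FarJoined x w u := by
  intro R
  obtain ⟨N, hN⟩ := h R
  obtain ⟨N', hN'⟩ := h' R
  exact ⟨max N N', fun p q hp hq => (hN p (max N N') (by omega) (by omega)).trans
    (hN' (max N N') q (by omega) (by omega))⟩

variable [IsIsometricSMul G X]

theorem exists_letter_bound (hS : S.Finite) (x : X) :
    ∃ M : ℝ, 0 ≤ M ∧ ∀ s : Letter S, dist x (s.1 • x) ≤ M := by
  obtain ⟨M, hM⟩ := (hS.image fun s => dist x (s • x)).bddAbove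
  refine ⟨max M 0, le_max_right _ _, fun s => le_max_of_le_left ?_⟩
  rcases s.2 with h | h
  · exact hM ⟨_, h, rfl⟩
  · rw [← dist_smul_inv]; exact hM ⟨_, h, rfl⟩

theorem joinedIn_letter (hX : IsGeodesicSpace X) {x : X} {M R : ℝ}
    (hM : ∀ s : Letter S, dist x (s.1 • x) ≤ M) (a : G) (s : Letter S)
    (ha : R + M < dist x (a • x)) :
    JoinedIn {z | R < dist x z} (a • x) ((a * s.1) • x) := by
  obtain ⟨γ, hγ⟩ := hX.exists_path (a • x) ((a * s.1) • x)
  refine ⟨γ, fun t => ?_⟩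
  have h1 := hγ t
  rw [dist_mul_smul] at h1
  have h2 := dist_triangle x (γ t) (a • x)
  rw [dist_comm (γ t)] at h2
  have h3 := hM s
  have h4 := dist_nonneg (x := γ t) (y := (a * s.1) • x)
  change R < dist x (γ t)
  linarith

theorem joinedIn_word (hX : IsGeodesicSpace X) {x : X} {M R : ℝ} (hM0 : 0 ≤ M)
    (hM : ∀ s : Letter S, dist x (s.1 • x) ≤ M) (d : List (Letter S)) (a : G)
    (ha : ∀ k ≤ d.length, R + M < dist x ((a * wordProd (d.take k)) • x)) :
    JoinedIn {z | R < dist x z} (a • x) ((a * wordProd d) • x) := by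
  induction d generalizing a with
  | nil =>
    have := ha 0 le_rfl
    simp only [List.take_nil] at this
    simp only [wordProd, List.map_nil, List.prod_nil, mul_one] at this ⊢
    exact JoinedIn.refl (by change R < _; linarith)
  | cons s d ih =>
    have h0 := ha 0 (Nat.zero_le _)
    simp only [List.take_zero, wordProd, List.map_nil, List.prod_nil, mul_one] at h0
    rw [wordProd_cons, ← mul_assoc]
    refine (joinedIn_letter hX hM a s h0).trans (ih _ fun k hk => ?_)
    have := ha (k + 1) (by simpa using hk)
    rwa [List.take_succ_cons, wordProd_cons, ← mul_assoc] at this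

variable {f : G → ℝ} {x : X} {A : ℝ}

/-- Nonzero sign sends `|f|`, hence the displacement, to infinity along the word, and consecutive
prefixes are joined by short geodesics. -/
theorem farJoined_refl (hX : IsGeodesicSpace X) (hS : S.Finite)
    (hA : ∀ g, |f g| ≤ dist x (g • x) + A) {w : ℕ → Letter S}
    (hw : wordSign f w = 1 ∨ wordSign f w = -1) : FarJoined x w w := by
  obtain ⟨M, hM0, hM⟩ := exists_letter_bound hS x
  intro R
  obtain ⟨N, hN⟩ := exists_lt_abs_prefix hw (R + M + A)
  have hfar : ∀ n, N ≤ n → R + M < dist x (prefixProd w n • x) := fun n hn => by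
    linarith [hN n hn, hA (prefixProd w n)]
  have key : ∀ n, N ≤ n →
      JoinedIn {z | R < dist x z} (prefixProd w N • x) (prefixProd w n • x) := by
    intro n hn
    induction n, hn using Nat.le_induction with
    | base => exact JoinedIn.refl (by change R < _; linarith [hfar N le_rfl])
    | succ n hn ih =>
      rw [prefixProd_succ]
      exact ih.trans (joinedIn_letter hX hM _ _ (hfar n hn))
  exact ⟨N, fun p q hp hq => (key p hp).symm.trans (key q hq)⟩

/-- A connecting word at a high level `D` consists of elements with large `|f|`, hence traces a path
far from `x`. Its ends are late prefixes, since `f` is bounded on the early ones. -/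
theorem WordEquivAt.farJoined (hX : IsGeodesicSpace X) (hS : S.Finite)
    (hA : ∀ g, |f g| ≤ dist x (g • x) + A) {w v : ℕ → Letter S} {C : ℝ}
    (hw : wordSign f w = 1 ∨ wordSign f w = -1) (h : WordEquivAt f C w v) : FarJoined x w v := by
  obtain ⟨M, hM0, hM⟩ := exists_letter_bound hS x
  obtain ⟨hsign, hD⟩ := h
  intro R
  obtain ⟨N, hN⟩ := farJoined_refl hX hS hA hw R
  obtain ⟨N', hN'⟩ := farJoined_refl hX hS hA (hsign ▸ hw) R
  obtain ⟨B, hB⟩ := ((Set.finite_lt_nat N).image fun n => |f (prefixProd w n)|).bddAbove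
  obtain ⟨B', hB'⟩ := ((Set.finite_lt_nat N').image fun n => |f (prefixProd v n)|).bddAbove
  -- `R + M + A + C` keeps the connecting path out of the ball; `B + C` and `B' + C` force its ends
  -- beyond `N` and `N'`.
  obtain ⟨T, hT⟩ : ∃ T : ℝ, 0 ≤ T ∧ C < T ∧ R + M + A + C < T ∧ B + C < T ∧ B' + C < T := by
    refine ⟨|C| + |R + M + A + C| + |B + C| + |B' + C| + 1, ?_⟩
    have := abs_nonneg C
    have := abs_nonneg (R + M + A + C)
    have := abs_nonneg (B + C)
    have := abs_nonneg (B' + C)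
    refine ⟨by linarith, ?_, ?_, ?_, ?_⟩
    · linarith [le_abs_self C]
    · linarith [le_abs_self (R + M + A + C)]
    · linarith [le_abs_self (B + C)]
    · linarith [le_abs_self (B' + C)]
  obtain ⟨hT0, hT1, hT2, hT3, hT4⟩ := hT
  have hσ : ((wordSign f w : ℤ) : ℝ) * ((wordSign f w : ℤ) * T) = T ∧
      |((wordSign f w : ℤ) : ℝ) * T| = T := by
    rcases hw with h | h <;> rw [h] <;> simp [abs_of_nonneg hT0]
  obtain ⟨p, q, d, hd, hk⟩ := hD ((wordSign f w : ℤ) * T) (by rw [hσ.1]; exact hT1)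
  have habs : ∀ k ≤ d.length, T - C ≤ |f (prefixProd w p * wordProd (d.take k))| := by
    intro k hkd
    have h1 := hk k hkd
    have h2 := abs_sub_abs_le_abs_sub (((wordSign f w : ℤ) : ℝ) * T)
      (f (prefixProd w p * wordProd (d.take k)))
    rw [hσ.2, abs_sub_comm] at h2
    linarith
  have hp : N ≤ p := by
    by_contra hlt
    have h1 := habs 0 (Nat.zero_le _)
    simp only [List.take_zero, wordProd, List.map_nil, List.prod_nil, mul_one] at h1
    have h2 := hB ⟨p, not_le.mp hlt, rfl⟩
    simp only at h2
    linarith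
  have hq : N' ≤ q := by
    by_contra hlt
    have h1 := habs _ le_rfl
    rw [List.take_length, hd] at h1
    have h2 := hB' ⟨q, not_le.mp hlt, rfl⟩
    simp only at h2
    linarith
  have hjoin := joinedIn_word (R := R) hX hM0 hM d (prefixProd w p) fun k hkd => by
    have h1 := habs k hkd
    have h2 := hA (prefixProd w p * wordProd (d.take k))
    linarith
  rw [hd] at hjoin
  refine ⟨max N N', fun p' q' hp' hq' => ?_⟩
  exact ((hN p' p (by omega) hp).trans hjoin).trans (hN' q q' hq (by omega))

/-- Equality in a `Quot` only gives the generated equivalence relation, so the geometric invariant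
has to pass through chains of equivalences. -/
theorem farJoined_of_mk_eq (hX : IsGeodesicSpace X) (hS : S.Finite)
    (hA : ∀ g, |f g| ≤ dist x (g • x) + A) {w v : SignedWord f S}
    (h : (Quot.mk _ w : EndSpace f S) = Quot.mk _ v) : FarJoined x w.1 v.1 := by
  have := Quot.eqvGen_exact h
  clear h
  induction this with
  | rel w v h =>
    obtain ⟨C, hC⟩ := h
    exact hC.farJoined hX hS hA w.2
  | refl w => exact farJoined_refl hX hS hA w.2
  | symm w v _ ih => exact ih.symm
  | trans w v u _ _ ih ih' =>
    exact ih.trans ih'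

/-- Words whose prefixes diverge in a quasi-tree represent different elements of `E(f)`. -/
theorem mk_ne_mk_of_gromovProduct_le {δ : ℝ} (hX : IsQuasiTree X) (h4 : FourPoint X δ)
    (hS : S.Finite) (hA : ∀ g, |f g| ≤ dist x (g • x) + A) {w v : SignedWord f S} {e : ℝ}
    (he : ∀ N, ∃ p q, N ≤ p ∧ N ≤ q ∧
      gromovProduct x (prefixProd w.1 p • x) (prefixProd v.1 q • x) ≤ e) :
    (Quot.mk _ w : EndSpace f S) ≠ Quot.mk _ v := by
  intro heq
  obtain ⟨R, -, HR⟩ := hX.exists_bottleneck h4 e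
  obtain ⟨N, hN⟩ := farJoined_of_mk_eq hX.geodesic hS hA heq R
  obtain ⟨p, q, hp, hq, hpq⟩ := he N
  obtain ⟨γ, hγ⟩ := hN p q hp hq
  obtain ⟨t, ht⟩ := HR _ _ _ hpq γ
  have := hγ t
  rw [dist_comm] at ht
  exact absurd ht (not_le.mpr this)

theorem exists_words_mk_ne {δ : ℝ} (hX : IsQuasiTree X) (h4 : FourPoint X δ)
    (hf : IsPseudocharacter f) (hS : S.Finite) (hgen : Subgroup.closure S = ⊤)
    (hA : ∀ g, |f g| ≤ dist x (g • x) + A) {a b : G} (ha : f a ≠ 0) (hab : f b = f a) {e : ℝ}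
    (he : ∀ i j : ℕ, 0 < i → 0 < j → gromovProduct x (a ^ i • x) (b ^ j • x) ≤ e) :
    ∃ w v : SignedWord f S, (0 < f a → wordSign f w.1 = 1 ∧ wordSign f v.1 = 1) ∧
      (f a < 0 → wordSign f w.1 = -1 ∧ wordSign f v.1 = -1) ∧
      (Quot.mk _ w : EndSpace f S) ≠ Quot.mk _ v := by
  obtain ⟨w, w1, w2, L, hL, hwL⟩ := hf.exists_periodic_word (S := S) hgen ha
  obtain ⟨v, v1, v2, L', hL', hvL⟩ := hf.exists_periodic_word (S := S) hgen (a := b)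
    (by rwa [hab])
  rw [hab] at v1 v2
  have hw : wordSign f w = 1 ∨ wordSign f w = -1 := ha.lt_or_gt.symm.imp w1 w2
  have hv : wordSign f v = 1 ∨ wordSign f v = -1 := ha.lt_or_gt.symm.imp v1 v2
  refine ⟨⟨w, hw⟩, ⟨v, hv⟩, fun h => ⟨w1 h, v1 h⟩, fun h => ⟨w2 h, v2 h⟩,
    mk_ne_mk_of_gromovProduct_le hX h4 hS hA (e := e) fun N => ⟨L * (N + 1), L' * (N + 1), ?_, ?_,
      ?_⟩⟩
  · nlinarith
  · nlinarith
  · rw [hwL, hvL]; exact he _ _ (by omega) (by omega)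

theorem two_le_encard_of_ne {α : Type*} {s : Set α} {a b : α} (ha : a ∈ s) (hb : b ∈ s)
    (hab : a ≠ b) : 2 ≤ s.encard := by
  have h := Order.add_one_le_of_lt (Set.one_lt_encard_iff.mpr ⟨a, b, ha, hb, hab⟩)
  rwa [one_add_one_eq_two] at h

theorem two_le_positiveEnds {δ : ℝ} (hX : IsQuasiTree X) (h4 : FourPoint X δ)
    (hf : IsPseudocharacter f) (hS : S.Finite) (hgen : Subgroup.closure S = ⊤)
    (hA : ∀ g, |f g| ≤ dist x (g • x) + A) {a b : G} (ha : 0 < f a) (hab : f b = f a) {e : ℝ}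
    (he : ∀ i j : ℕ, 0 < i → 0 < j → gromovProduct x (a ^ i • x) (b ^ j • x) ≤ e) :
    2 ≤ (positiveEnds f S).encard := by
  obtain ⟨w, v, h1, -, hne⟩ := exists_words_mk_ne hX h4 hf hS hgen hA ha.ne' hab he
  exact two_le_encard_of_ne ⟨w, (h1 ha).1, rfl⟩ ⟨v, (h1 ha).2, rfl⟩ hne

theorem two_le_negativeEnds {δ : ℝ} (hX : IsQuasiTree X) (h4 : FourPoint X δ)
    (hf : IsPseudocharacter f) (hS : S.Finite) (hgen : Subgroup.closure S = ⊤)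
    (hA : ∀ g, |f g| ≤ dist x (g • x) + A) {a b : G} (ha : f a < 0) (hab : f b = f a) {e : ℝ}
    (he : ∀ i j : ℕ, 0 < i → 0 < j → gromovProduct x (a ^ i • x) (b ^ j • x) ≤ e) :
    2 ≤ (negativeEnds f S).encard := by
  obtain ⟨w, v, -, h1, hne⟩ := exists_words_mk_ne hX h4 hf hS hgen hA ha.ne hab he
  exact two_le_encard_of_ne ⟨w, (h1 ha).1, rfl⟩ ⟨v, (h1 ha).2, rfl⟩ hne

end Ends

end BestvinaFujiwara

namespace BestvinaFujiwara

/-! ### Periodic broken lines -/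

section Corner

/-- Let intervals `[t m, t (m + 1)]` of two alternating types tile a segment which contains
`b₀ ≤ b₁ ≤ b₂`. If `[b₀, b₁]` has small overlap with the intervals of even index and `[b₁, b₂]` with
those of odd index, then they are essentially contained in consecutive intervals. -/
theorem exists_consecutive_of_overlap_le {t : ℕ → ℝ} {M : ℕ} {L b₀ b₁ b₂ : ℝ}
    (hL : 0 ≤ L) (h0 : t 0 ≤ b₀) (h2 : b₂ ≤ t M + L) (hlong : ∀ m < M, L < t (m + 1) - t m)
    (hov₀ : ∀ m < M, Even m → ∀ s r, t m ≤ s → b₀ ≤ s → r ≤ t (m + 1) → r ≤ b₁ → r - s ≤ L)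
    (hov₁ : ∀ m < M, Odd m → ∀ s r, t m ≤ s → b₁ ≤ s → r ≤ t (m + 1) → r ≤ b₂ → r - s ≤ L)
    (h01 : 2 * L < b₁ - b₀) (h12 : 2 * L < b₂ - b₁) :
    ∃ m, Odd m ∧ m + 1 < M ∧ b₁ - b₀ ≤ t (m + 1) - t m + 2 * L ∧
      b₂ - b₁ ≤ t (m + 2) - t (m + 1) + 2 * L := by
  classical
  have hex : ∃ j, b₁ < t j := ⟨M, by linarith⟩
  obtain ⟨j, hjM, hj1, hj2⟩ : ∃ j < M, t j ≤ b₁ ∧ b₁ < t (j + 1) := by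
    have hpos : Nat.find hex ≠ 0 := by
      intro h
      have := Nat.find_spec hex
      rw [h] at this
      linarith
    have hle : Nat.find hex ≤ M := Nat.find_min' hex (by linarith)
    refine ⟨Nat.find hex - 1, by omega, not_lt.mp (Nat.find_min hex (by omega)), ?_⟩
    rw [Nat.sub_add_cancel (by omega)]
    exact Nat.find_spec hex
  -- The point `b₁` is `L`-close to the end of an interval of odd index. If `j` is even, `[b₀, b₁]`
  -- reaches at most `L` into interval `j`, so `m = j - 1`; if `j` is odd, `[b₁, b₂]` leaves
  -- interval `j` within `L`, so `m = j`.
  obtain ⟨m, hm, hmM, hm1, hm2⟩ : ∃ m, Odd m ∧ m + 1 < M ∧ b₁ - L ≤ t (m + 1) ∧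
      t (m + 1) ≤ b₁ + L := by
    rcases Nat.even_or_odd j with hj | hj
    · have h3 := hov₀ j hjM hj (max (t j) b₀) b₁ (le_max_left _ _) (le_max_right _ _) hj2.le le_rfl
      rcases max_cases (t j) b₀ with ⟨e, _⟩ | ⟨e, _⟩ <;> rw [e] at h3
      · rcases Nat.eq_zero_or_pos j with rfl | hpos
        · linarith
        · refine ⟨j - 1, ?_, by omega, ?_, ?_⟩
          · rw [Nat.odd_iff]; rw [Nat.even_iff] at hj; omega
          · rw [Nat.sub_add_cancel hpos]; linarith
          · rw [Nat.sub_add_cancel hpos]; linarith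
      · linarith
    · have h3 := hov₁ j hjM hj b₁ (min b₂ (t (j + 1))) hj1 le_rfl (min_le_right _ _)
        (min_le_left _ _)
      rcases min_cases b₂ (t (j + 1)) with ⟨e, _⟩ | ⟨e, _⟩ <;> rw [e] at h3
      · linarith
      · refine ⟨j, hj, ?_, by linarith, by linarith⟩
        rcases (show j + 1 ≤ M from hjM).eq_or_lt with h | h
        · rw [h] at h3; linarith
        · exact h
  have hl1 := hlong m (by omega)
  have hl2 := hlong (m + 1) hmM
  -- Otherwise `[b₀, b₁]` would overlap the even interval `m - 1` in more than `L`; `k2` is the same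
  -- for `[b₁, b₂]` and the odd interval `m + 2`.
  have k0 : t m - L ≤ b₀ := by
    by_contra! hlt
    obtain ⟨i, rfl⟩ : ∃ i, m = i + 1 := ⟨m - 1, by rw [Nat.odd_iff] at hm; omega⟩
    have hi : Even i := by rw [Nat.even_iff]; rw [Nat.odd_iff] at hm; omega
    have h3 := hov₀ i (by omega) hi (max (t i) b₀) (t (i + 1)) (le_max_left _ _) (le_max_right _ _)
      le_rfl (by linarith)
    have h4 := hlong i (by omega)
    rcases max_cases (t i) b₀ with ⟨e, _⟩ | ⟨e, _⟩ <;> rw [e] at h3 <;> linarith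
  have k2 : b₂ ≤ t (m + 2) + L := by
    rcases (show m + 2 ≤ M from hmM).eq_or_lt with h | h
    · rwa [h]
    · by_contra! hlt
      have hi : Odd (m + 2) := by rw [Nat.odd_iff] at hm ⊢; omega
      have h3 := hov₁ (m + 2) h hi (t (m + 2)) (min (t (m + 3)) b₂) le_rfl
        (by rw [show m + 1 + 1 = m + 2 from rfl] at hl2; linarith) (min_le_left _ _)
        (min_le_right _ _)
      have h4 := hlong (m + 2) h
      rw [show m + 2 + 1 = m + 3 from rfl] at h4
      rcases min_cases (t (m + 3)) b₂ with ⟨e, _⟩ | ⟨e, _⟩ <;> rw [e] at h3 <;> linarith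
  exact ⟨m, hm, hmM, by linarith, by linarith⟩

variable {G : Type u} [Group G]

/-- The letters of the periodic bi-infinite word `⋯ g ^ N h ^ N g ^ k h ^ k ⋯`. -/
def cornerStep (g h : G) (N k : ℕ) (i : ℤ) : G :=
  (if i % 2 = 0 then g else h) ^ (if i % 4 < 2 then N else k)

/-- The period of the word `⋯ g ^ N h ^ N g ^ k h ^ k ⋯`. -/
def cornerElement (g h : G) (N k : ℕ) : G := g ^ N * h ^ N * (g ^ k * h ^ k)

/-- The vertices of the broken line spelled by `⋯ g ^ N h ^ N g ^ k h ^ k ⋯`. -/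
def cornerPath (g h : G) (N k : ℕ) (i : ℤ) : G :=
  cornerElement g h N k ^ (i / 4) *
    (if i % 4 = 0 then 1 else if i % 4 = 1 then g ^ N else if i % 4 = 2 then g ^ N * h ^ N
      else g ^ N * h ^ N * g ^ k)

variable (g h : G) (N k : ℕ)

theorem cornerPath_succ (i : ℤ) :
    cornerPath g h N k (i + 1) = cornerPath g h N k i * cornerStep g h N k i := by
  obtain ⟨j, r, hr0, hr4, rfl⟩ : ∃ j r : ℤ, 0 ≤ r ∧ r < 4 ∧ i = 4 * j + r :=
    ⟨i / 4, i % 4, by omega, by omega, by omega⟩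
  simp only [cornerPath, cornerStep]
  interval_cases r
  · rw [show (4 * j + 0) / 4 = j by omega, show (4 * j + 0 + 1) / 4 = j by omega,
      show (4 * j + 0) % 4 = 0 by omega, show (4 * j + 0 + 1) % 4 = 1 by omega,
      show (4 * j + 0) % 2 = 0 by omega]
    simp
  · rw [show (4 * j + 1) / 4 = j by omega, show (4 * j + 1 + 1) / 4 = j by omega,
      show (4 * j + 1) % 4 = 1 by omega, show (4 * j + 1 + 1) % 4 = 2 by omega,
      show (4 * j + 1) % 2 = 1 by omega]
    simp [mul_assoc]
  · rw [show (4 * j + 2) / 4 = j by omega, show (4 * j + 2 + 1) / 4 = j by omega,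
      show (4 * j + 2) % 4 = 2 by omega, show (4 * j + 2 + 1) % 4 = 3 by omega,
      show (4 * j + 2) % 2 = 0 by omega]
    simp [mul_assoc]
  · rw [show (4 * j + 3) / 4 = j by omega, show (4 * j + 3 + 1) / 4 = j + 1 by omega,
      show (4 * j + 3) % 4 = 3 by omega, show (4 * j + 3 + 1) % 4 = 0 by omega,
      show (4 * j + 3) % 2 = 1 by omega]
    simp [zpow_add_one, cornerElement, mul_assoc]

theorem cornerPath_four_mul (i : ℤ) :
    cornerPath g h N k (4 * i) = cornerElement g h N k ^ i := by
  simp [cornerPath]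

theorem cornerPath_zero : cornerPath g h N k 0 = 1 := by simp [cornerPath]

theorem cornerPath_four_mul_add_one (i : ℤ) :
    cornerPath g h N k (4 * i + 1) = cornerElement g h N k ^ i * g ^ N := by
  rw [cornerPath_succ, cornerPath_four_mul]
  simp [cornerStep, show (4 * i) % 2 = 0 by omega]

theorem cornerStep_of_even {i : ℤ} (hi : i % 2 = 0) :
    cornerStep g h N k i = g ^ (if i % 4 < 2 then N else k) := by
  simp [cornerStep, hi]

theorem cornerStep_of_odd {i : ℤ} (hi : i % 2 = 1) :
    cornerStep g h N k i = h ^ (if i % 4 < 2 then N else k) := by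
  simp [cornerStep, hi]

variable {X : Type v} [MetricSpace X] [MulAction G X] [IsIsometricSMul G X] (x : X)

theorem dist_cornerPath_succ (i : ℤ) :
    dist (cornerPath g h N k i • x) (cornerPath g h N k (i + 1) • x) =
      dist x (cornerStep g h N k i • x) := by
  rw [cornerPath_succ, dist_mul_smul]

theorem gromovProduct_cornerPath (i : ℤ) :
    gromovProduct (cornerPath g h N k i • x) (cornerPath g h N k (i - 1) • x)
        (cornerPath g h N k (i + 1) • x) =
      gromovProduct x ((cornerStep g h N k (i - 1))⁻¹ • x) (cornerStep g h N k i • x) := by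
  have h1 : cornerPath g h N k (i - 1) =
      cornerPath g h N k i * (cornerStep g h N k (i - 1))⁻¹ := by
    have := cornerPath_succ g h N k (i - 1)
    rw [sub_add_cancel] at this
    rw [this, mul_inv_cancel_right]
  rw [h1, cornerPath_succ, mul_smul, mul_smul, gromovProduct_smul]

end Corner

/-! ### Bounded turns and divergence of the corner path -/

section CornerQuasiGeodesic

variable {G : Type u} [Group G] {X : Type v} [MetricSpace X] [MulAction G X] [IsIsometricSMul G X]
  {g₁ g₂ : G} {x : X} {C δ : ℝ} {N k : ℕ}

/-- Because the second letter is `g₂⁻¹`, the two edges at a vertex point along powers of `g₁` and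
`g₂` with exponents of equal sign, and independence bounds their product. -/
theorem cornerPath_local
    (hC : ∀ i j : ℤ, gromovProduct x (g₁ ^ i • x) (g₂ ^ j • x) ≤ C) (i : ℤ) :
    gromovProduct (cornerPath g₁ g₂⁻¹ N k i • x) (cornerPath g₁ g₂⁻¹ N k (i - 1) • x)
      (cornerPath g₁ g₂⁻¹ N k (i + 1) • x) ≤ C := by
  rw [gromovProduct_cornerPath]
  rcases Int.emod_two_eq_zero_or_one i with hi | hi
  · rw [cornerStep_of_even _ _ _ _ hi, cornerStep_of_odd _ _ _ _ (show (i - 1) % 2 = 1 by omega),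
      gromovProduct_comm, inv_pow, inv_inv]
    exact_mod_cast hC (if i % 4 < 2 then N else k : ℕ) (if (i - 1) % 4 < 2 then N else k : ℕ)
  · rw [cornerStep_of_odd _ _ _ _ hi, cornerStep_of_even _ _ _ _ (show (i - 1) % 2 = 0 by omega),
      inv_pow, ← zpow_natCast, ← zpow_natCast, ← zpow_neg, ← zpow_neg]
    exact hC _ _

theorem le_dist_cornerStep {R : ℝ} (h₁ : ∀ n, k ≤ n → R ≤ dist x (g₁ ^ n • x))
    (h₂ : ∀ n, k ≤ n → R ≤ dist x (g₂ ^ n • x)) (hkN : k ≤ N) (i : ℤ) :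
    R ≤ dist x (cornerStep g₁ g₂⁻¹ N k i • x) := by
  rcases Int.emod_two_eq_zero_or_one i with hi | hi
  · rw [cornerStep_of_even _ _ _ _ hi]
    apply h₁; split_ifs <;> omega
  · rw [cornerStep_of_odd _ _ _ _ hi, inv_pow, dist_smul_inv]
    apply h₂; split_ifs <;> omega

theorem cornerPath_global (h4 : FourPoint X δ) (hδ : 0 ≤ δ) (hC0 : 0 ≤ C)
    (hC : ∀ i j : ℤ, gromovProduct x (g₁ ^ i • x) (g₂ ^ j • x) ≤ C)
    (hlong : ∀ i, 2 * C + 4 * δ < dist x (cornerStep g₁ g₂⁻¹ N k i • x)) {i j l : ℤ}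
    (hij : i ≤ j) (hjl : j ≤ l) :
    gromovProduct (cornerPath g₁ g₂⁻¹ N k j • x) (cornerPath g₁ g₂⁻¹ N k i • x)
      (cornerPath g₁ g₂⁻¹ N k l • x) ≤ C + 2 * δ :=
  h4.chain hδ hC0 (u := fun i => cornerPath g₁ g₂⁻¹ N k i • x) (cornerPath_local hC)
    (fun i => by rw [dist_cornerPath_succ]; exact hlong i) hij hjl

theorem le_dist_cornerPath_succ (h4 : FourPoint X δ) (hδ : 0 ≤ δ) (hC0 : 0 ≤ C)
    (hC : ∀ i j : ℤ, gromovProduct x (g₁ ^ i • x) (g₂ ^ j • x) ≤ C)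
    (hlong : ∀ i, 2 * C + 4 * δ < dist x (cornerStep g₁ g₂⁻¹ N k i • x)) {i : ℤ} (hi : 0 ≤ i) :
    dist x (cornerPath g₁ g₂⁻¹ N k i • x) + dist x (cornerStep g₁ g₂⁻¹ N k i • x) -
      2 * (C + 2 * δ) ≤ dist x (cornerPath g₁ g₂⁻¹ N k (i + 1) • x) := by
  have h1 := cornerPath_global h4 hδ hC0 hC hlong hi (show i ≤ i + 1 by omega)
  rw [cornerPath_zero, one_smul] at h1
  have h2 := dist_cornerPath_succ g₁ g₂⁻¹ N k x i
  rw [dist_comm] at h2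
  unfold gromovProduct at h1
  linarith

/-- The powers of the corner element move the base point almost as far as possible. -/
theorem le_dist_cornerElement_pow (h4 : FourPoint X δ) (hδ : 0 ≤ δ) (hC0 : 0 ≤ C)
    (hC : ∀ i j : ℤ, gromovProduct x (g₁ ^ i • x) (g₂ ^ j • x) ≤ C)
    (hlong : ∀ i, 2 * C + 4 * δ < dist x (cornerStep g₁ g₂⁻¹ N k i • x)) (n : ℕ) :
    n * (dist x (g₁ ^ N • x) + dist x (g₂ ^ N • x) + dist x (g₁ ^ k • x) + dist x (g₂ ^ k • x) -
      8 * (C + 2 * δ)) ≤ dist x (cornerElement g₁ g₂⁻¹ N k ^ n • x) := by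
  induction n with
  | zero => simp
  | succ n ih =>
    have step := fun i hi => le_dist_cornerPath_succ h4 hδ hC0 hC hlong (i := i) hi
    have s0 := step (4 * n) (by omega)
    have s1 := step (4 * n + 1) (by omega)
    have s2 := step (4 * n + 2) (by omega)
    have s3 := step (4 * n + 3) (by omega)
    rw [cornerPath_four_mul, zpow_natCast, cornerStep_of_even _ _ _ _ (by omega),
      if_pos (by omega)] at s0
    rw [cornerStep_of_odd _ _ _ _ (by omega), if_pos (by omega), inv_pow, dist_smul_inv,
      show (4 * (n : ℤ) + 1 + 1) = 4 * n + 2 by ring] at s1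
    rw [cornerStep_of_even _ _ _ _ (by omega), if_neg (by omega),
      show (4 * (n : ℤ) + 2 + 1) = 4 * n + 3 by ring] at s2
    rw [cornerStep_of_odd _ _ _ _ (by omega), if_neg (by omega), inv_pow, dist_smul_inv,
      show (4 * (n : ℤ) + 3 + 1) = 4 * (n + 1 : ℕ) by push_cast; ring, cornerPath_four_mul,
      zpow_natCast] at s3
    push_cast
    linarith

/-- The positive powers of the corner element and of a cyclic conjugate diverge. -/
theorem gromovProduct_cornerElement_pow_le (h4 : FourPoint X δ) (hδ : 0 ≤ δ) (hC0 : 0 ≤ C)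
    (hC : ∀ i j : ℤ, gromovProduct x (g₁ ^ i • x) (g₂ ^ j • x) ≤ C)
    (hlong : ∀ i, 2 * (C + 2 * δ) + 3 * δ < dist x (cornerStep g₁ g₂⁻¹ N k i • x)) (i j : ℕ)
    (hi : 0 < i) (hj : 0 < j) :
    gromovProduct x (cornerElement g₁ g₂⁻¹ N k ^ i • x)
      (((g₁ ^ N)⁻¹ * cornerElement g₁ g₂⁻¹ N k * g₁ ^ N) ^ j • x) ≤ C + 2 * δ + 2 * δ := by
  have hglob := fun {i j l : ℤ} => cornerPath_global (N := N) (k := k) (i := i)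
    (j := j) (l := l) h4 hδ hC0 hC
    (fun i => by linarith [hlong i])
  have u1 : cornerPath g₁ g₂⁻¹ N k 1 = g₁ ^ N := by
    simpa using cornerPath_four_mul_add_one g₁ g₂⁻¹ N k 0
  have u2 : cornerPath g₁ g₂⁻¹ N k 2 = g₁ ^ N * (g₂ ^ N)⁻¹ := by
    have := cornerPath_succ g₁ g₂⁻¹ N k 1
    rw [u1] at this
    simpa [cornerStep] using this
  have l0 := hlong 0
  have l1 := hlong 1
  rw [cornerStep_of_even _ _ _ _ (by norm_num), if_pos (by norm_num)] at l0
  rw [cornerStep_of_odd _ _ _ _ (by norm_num), if_pos (by norm_num), inv_pow] at l1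
  -- The corner element sets out along `g₁ ^ N`; its conjugate spells the same line read from vertex
  -- `1` and sets out along `(g₂ ^ N)⁻¹`.
  refine h4.two_rays hδ (p := g₁ ^ N • x) (q := (g₂ ^ N)⁻¹ • x) ?_ ?_ ?_ l0
    l1
  · refine le_trans ?_ (le_add_of_nonneg_right (by positivity) : C ≤ C + 2 * δ)
    simpa using hC N (-N)
  · have := hglob (i := 0) (j := 1) (l := 4 * i) (by omega) (by omega)
    rwa [u1, cornerPath_zero, one_smul, cornerPath_four_mul, zpow_natCast] at this
  · have := hglob (i := 1) (j := 2) (l := 4 * j + 1) (by omega) (by omega)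
    rw [u1, u2, cornerPath_four_mul_add_one, zpow_natCast] at this
    rw [← gromovProduct_smul (g₁ ^ N), smul_smul, smul_smul]
    convert this using 3
    have := conj_pow (a := (g₁ ^ N)⁻¹) (b := cornerElement g₁ g₂⁻¹ N k) (i := j)
    rw [inv_inv] at this
    rw [this]
    group

/-- The negative powers of the corner element and of a cyclic conjugate diverge. -/
theorem gromovProduct_cornerElement_inv_pow_le (h4 : FourPoint X δ) (hδ : 0 ≤ δ) (hC0 : 0 ≤ C)
    (hC : ∀ i j : ℤ, gromovProduct x (g₁ ^ i • x) (g₂ ^ j • x) ≤ C)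
    (hlong : ∀ i, 2 * (C + 2 * δ) + 3 * δ < dist x (cornerStep g₁ g₂⁻¹ N k i • x)) (i j : ℕ)
    (hi : 0 < i) (hj : 0 < j) :
    gromovProduct x ((cornerElement g₁ g₂⁻¹ N k)⁻¹ ^ i • x)
      (((g₁ ^ N)⁻¹ * cornerElement g₁ g₂⁻¹ N k * g₁ ^ N)⁻¹ ^ j • x) ≤ C + 2 * δ + 2 * δ := by
  have hglob := fun {i j l : ℤ} => cornerPath_global (N := N) (k := k) (i := i)
    (j := j) (l := l) h4 hδ hC0 hC
    (fun i => by linarith [hlong i])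
  have u1 : cornerPath g₁ g₂⁻¹ N k 1 = g₁ ^ N := by
    simpa using cornerPath_four_mul_add_one g₁ g₂⁻¹ N k 0
  have u2 : cornerPath g₁ g₂⁻¹ N k (-1) = g₂ ^ k := by
    have := cornerPath_succ g₁ g₂⁻¹ N k (-1)
    rw [show (-1 : ℤ) + 1 = 0 by norm_num, cornerPath_zero,
      cornerStep_of_odd _ _ _ _ (by norm_num), if_neg (by norm_num), inv_pow] at this
    exact (mul_inv_eq_one.mp this.symm)
  have l0 := hlong 0
  have l1 := hlong (-1)
  rw [cornerStep_of_even _ _ _ _ (by norm_num), if_pos (by norm_num)] at l0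
  rw [cornerStep_of_odd _ _ _ _ (by norm_num), if_neg (by norm_num), inv_pow, dist_smul_inv] at l1
  -- Read backwards, the line starts with `g₂ ^ k` from vertex `0` and with `(g₁ ^ N)⁻¹` from vertex
  -- `1`.
  refine h4.two_rays hδ (p := g₂ ^ k • x) (q := (g₁ ^ N)⁻¹ • x) ?_ ?_ ?_ l1
    (by rwa [dist_smul_inv])
  · refine le_trans ?_ (le_add_of_nonneg_right (by positivity) : C ≤ C + 2 * δ)
    rw [gromovProduct_comm]
    simpa using hC (-N) k
  · have := hglob (i := 4 * (-i : ℤ)) (j := -1) (l := 0) (by omega) (by omega)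
    rw [u2, cornerPath_zero, one_smul, cornerPath_four_mul, gromovProduct_comm] at this
    simpa using this
  · have := hglob (i := 4 * (-j : ℤ) + 1) (j := 0) (l := 1) (by omega) (by omega)
    rw [u1, cornerPath_zero, cornerPath_four_mul_add_one, gromovProduct_comm] at this
    rw [← gromovProduct_smul (g₁ ^ N), smul_smul, smul_smul]
    convert this using 3
    · simp
    · have := conj_pow (a := (g₁ ^ N)⁻¹) (b := cornerElement g₁ g₂⁻¹ N k) (i := j)
      rw [inv_inv] at this
      rw [inv_pow, this]
      group

end CornerQuasiGeodesic

end BestvinaFujiwara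

namespace BestvinaFujiwara

/-! ### The bushy pseudocharacter -/

section Main

variable {G : Type u} [Group G] {X : Type v} [MetricSpace X] [MulAction G X] [IsIsometricSMul G X]

/-- Jumps along translates of the turn from the axis of `g₁` to the axis of `g₂⁻¹` do not help to
travel backwards along the axis of a corner element. -/
theorem corner_jump_le {g₁ g₂ : G} {x : X} {C δ W L : ℝ} {N k : ℕ} (h4 : FourPoint X δ)
    (hδ : 0 ≤ δ) (hC0 : 0 ≤ C) (hW : 0 ≤ W)
    (hC : ∀ i j : ℤ, gromovProduct x (g₁ ^ i • x) (g₂ ^ j • x) ≤ C) {B : ℝ}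
    (hB : B = C + 2 * (W + δ) + δ) (hLB : 2 * B ≤ L)
    (hov : ∀ (x' y' : X) (h h' : G) (n m : ℕ) (s t : ℝ),
      gromovProduct (h • x) x' y' ≤ B → gromovProduct (h • g₁ ^ n • x) x' y' ≤ B →
      gromovProduct (h' • x) x' y' ≤ B → gromovProduct (h' • g₂ ^ m • x) x' y' ≤ B →
      dist x' (h • x) ≤ s → t ≤ dist x' (h • g₁ ^ n • x) →
      dist x' (h' • x) ≤ s → t ≤ dist x' (h' • g₂ ^ m • x) → t - s ≤ L)
    (hov' : ∀ (x' y' : X) (h h' : G) (n m : ℕ) (s t : ℝ),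
      gromovProduct (h • x) x' y' ≤ B → gromovProduct (h • g₁ ^ n • x) x' y' ≤ B →
      gromovProduct (h' • x) x' y' ≤ B → gromovProduct (h' • g₂ ^ m • x) x' y' ≤ B →
      t ≤ dist x' (h • x) → dist x' (h • g₁ ^ n • x) ≤ s →
      t ≤ dist x' (h' • x) → dist x' (h' • g₂ ^ m • x) ≤ s → t - s ≤ L)
    (hlong : ∀ i, 2 * (C + 2 * δ) + L < dist x (cornerStep g₁ g₂⁻¹ N k i • x))
    {E : ℝ} (hE : E = 2 * C + 4 * (W + δ) + 2 * δ)
    (h₁ : dist x (g₁ ^ k • x) + 2 * L + E < dist x (g₁ ^ N • x))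
    (h₂ : dist x (g₂ ^ k • x) + 2 * L + E < dist x (g₂ ^ N • x))
    (hℓ : 2 * W + δ < dist ((g₁ ^ N)⁻¹ • x) ((g₂ ^ N)⁻¹ • x)) (n : ℕ) (g : G)
    {φ : X → ℝ}
    (hφ : φ = fun z => (dist z x - dist z (cornerElement g₁ g₂⁻¹ N k ^ n • x)) / 2) :
    φ (g • (g₁ ^ N)⁻¹ • x) - φ (g • (g₂ ^ N)⁻¹ • x) ≤
      dist ((g₁ ^ N)⁻¹ • x) ((g₂ ^ N)⁻¹ • x) - W := by
  by_contra! hcon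
  set y := cornerElement g₁ g₂⁻¹ N k ^ n • x with hy
  set P := g • (g₁ ^ N)⁻¹ • x with hP
  set Q := g • (g₂ ^ N)⁻¹ • x with hQ
  set O := g • x with hO
  set ℓ := dist ((g₁ ^ N)⁻¹ • x) ((g₂ ^ N)⁻¹ • x) with hℓdef
  have dPQ : dist P Q = ℓ := dist_smul _ _ _
  have dQO : dist Q O = dist x (g₂ ^ N • x) := by
    rw [hQ, hO, dist_smul, dist_comm, dist_smul_inv]
  have dOP : dist O P = dist x (g₁ ^ N • x) := by rw [hP, hO, dist_smul, dist_smul_inv]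
  have t1 := dist_triangle P Q x
  have t2 := dist_triangle Q P y
  have c1 := dist_comm P Q
  have c2 := dist_comm P x
  have c3 := dist_comm Q x
  have c4 := dist_comm y P
  have c5 := dist_comm y Q
  simp only [hφ] at hcon
  -- A jump that gains this much nearly realizes both triangle inequalities, so `x`, `Q`, `P`, `y`
  -- lie in this order along a geodesic.
  have q1 : gromovProduct Q x P ≤ W := by unfold gromovProduct; linarith
  have q2 : gromovProduct P Q y ≤ W := by unfold gromovProduct; linarith
  have hQxy : gromovProduct Q x y ≤ W + δ := h4.step q1 q2 (by linarith)
  have hPxy : gromovProduct P x y ≤ W + δ := by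
    rw [gromovProduct_comm]
    exact h4.step (by rwa [gromovProduct_comm]) (by rwa [gromovProduct_comm]) (by linarith)
  have hOQP : gromovProduct O Q P ≤ C := by
    rw [hO, hQ, hP, gromovProduct_smul, gromovProduct_comm]
    simpa using hC (-N) (-N)
  have hQP : dist x Q ≤ dist x P := by linarith
  have hOxy := h4.gromovProduct_mid hQxy hPxy hQP hOQP
  obtain ⟨b01, b12⟩ := h4.position_mid hQxy hPxy hQP hOQP
  rw [dQO, ← hE] at b01
  rw [dOP, ← hE] at b12
  rw [← hB] at hOxy
  have hWB : W + δ ≤ B := by linarith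
  have hCB : C + 2 * δ ≤ B := by linarith
  have hE0 : 0 ≤ E := by rw [hE]; positivity
  have hB0 : 0 ≤ B := by rw [hB]; positivity
  have hlong' : ∀ i, 2 * C + 4 * δ < dist x (cornerStep g₁ g₂⁻¹ N k i • x) := fun i => by
    linarith [hlong i]
  set u : ℕ → G := fun m => cornerPath g₁ g₂⁻¹ N k m with hu
  have hu0 : u 0 = 1 := cornerPath_zero _ _ _ _
  have huy : u (4 * n) • x = y := by
    simp only [hu, hy]
    push_cast
    rw [cornerPath_four_mul, zpow_natCast]
  have hnear : ∀ m ≤ 4 * n, gromovProduct (u m • x) x y ≤ B := by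
    intro m hm
    have := cornerPath_global h4 hδ hC0 hC hlong' (show (0 : ℤ) ≤ m by omega)
      (show (m : ℤ) ≤ (4 * n : ℕ) by exact_mod_cast hm)
    rw [cornerPath_zero, one_smul] at this
    rw [← huy]
    exact this.trans hCB
  have hstep : ∀ m, dist x (u m • x) + dist x (cornerStep g₁ g₂⁻¹ N k m • x) - 2 * (C + 2 * δ) ≤
      dist x (u (m + 1) • x) := fun m =>
    le_dist_cornerPath_succ h4 hδ hC0 hC hlong' (show (0 : ℤ) ≤ m by omega)
  have hstep' : ∀ m, dist x (u (m + 1) • x) ≤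
      dist x (u m • x) + dist x (cornerStep g₁ g₂⁻¹ N k m • x) := fun m => by
    have := dist_triangle x (u m • x) (u (m + 1) • x)
    rwa [show dist (u m • x) (u (m + 1) • x) = _ from dist_cornerPath_succ _ _ _ _ _ _] at this
  have hsucc : ∀ m, u (m + 1) = u m * cornerStep g₁ g₂⁻¹ N k m := fun m =>
    cornerPath_succ g₁ g₂⁻¹ N k m
  -- From `Q` to `O` runs a positive `g₂`-segment, compared with the even pieces (positive `g₁`);
  -- from `O` to `P` a negative `g₁`-segment, compared with the odd pieces (negative `g₂`).
  obtain ⟨m, hm, hmM, e1, e2⟩ := exists_consecutive_of_overlap_le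
    (t := fun m => dist x (u m • x)) (M := 4 * n) (L := L) (b₀ := dist x Q) (b₁ := dist x O)
    (b₂ := dist x P) (by linarith) (by simp [hu0]) (by
      simp only [huy]
      have : dist x P ≤ dist x y + 2 * (W + δ) := by
        unfold gromovProduct at hPxy
        linarith [dist_nonneg (x := P) (y := y)]
      linarith)
    (fun m _ => by linarith [hstep m, hlong m])
    (fun m hm he s r hs hs' hr hr' => by
      have hcs := hsucc m
      rw [cornerStep_of_even _ _ _ _ (by rw [Nat.even_iff] at he; omega)] at hcs
      simp only [hcs, mul_smul] at hr
      have k1 := hnear m hm.le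
      have k2 := hnear (m + 1) hm
      rw [hcs, mul_smul] at k2
      have k3 : (g * (g₂ ^ N)⁻¹) • x = Q := by rw [mul_smul]
      have k4 : (g * (g₂ ^ N)⁻¹) • g₂ ^ N • x = O := by rw [mul_smul, inv_smul_smul]
      exact hov x y (u m) (g * (g₂ ^ N)⁻¹) _ N s r k1 k2 (by rw [k3]; linarith)
        (by rw [k4]; exact hOxy) hs hr (by rwa [k3]) (by rwa [k4]))
    (fun m hm ho s r hs hs' hr hr' => by
      have hcs := hsucc m
      rw [cornerStep_of_odd _ _ _ _ (by rw [Nat.odd_iff] at ho; omega), inv_pow] at hcs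
      have hcs' := eq_mul_inv_iff_mul_eq.mp hcs
      have k1 := hnear m hm.le
      have k2 := hnear (m + 1) hm
      simp only [← hcs', mul_smul] at hs k1
      have k3 : (g * (g₁ ^ N)⁻¹) • x = P := by rw [mul_smul]
      have k4 : (g * (g₁ ^ N)⁻¹) • g₁ ^ N • x = O := by rw [mul_smul, inv_smul_smul]
      exact hov' x y (g * (g₁ ^ N)⁻¹) (u (m + 1)) N _ s r (by rw [k3]; linarith)
        (by rw [k4]; exact hOxy) k2 k1 (by rwa [k3]) (by rwa [k4]) hr hs)
    (by linarith [dist_nonneg (x := x) (y := g₂ ^ k • x)])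
    (by linarith [dist_nonneg (x := x) (y := g₁ ^ k • x)])
  have f1 := hstep' m
  have f2 := hstep' (m + 1)
  have ho := Nat.odd_iff.mp hm
  rw [cornerStep_of_odd _ _ _ _ (by omega), inv_pow, dist_smul_inv] at f1
  rw [cornerStep_of_even _ _ _ _ (by push_cast; omega)] at f2
  -- An odd piece and its successor have exponents `N, k` or `k, N`; the piece of exponent `k` is
  -- too short for a side of exponent `N`.
  rcases (show m % 4 = 1 ∨ m % 4 = 3 by omega) with h | h
  · rw [if_neg (by push_cast; omega)] at f2
    linarith
  · rw [if_neg (by omega)] at f1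
    linarith

/-- From inequivalent independent hyperbolic elements of a quasi-tree one gets a pseudocharacter
dominated by displacement, and two conjugate elements on which it does not vanish and whose powers
diverge in both directions. -/
theorem exists_pseudocharacter (hX : IsQuasiTree X) (hyp : IsGromovHyperbolic X) {g₁ g₂ : G}
    (h₁ : IsHyperbolicElement X g₁) (h₂ : IsHyperbolicElement X g₂) (hind : AreIndependent X g₁ g₂)
    (hne : ¬ AxisEquivalent X g₁ g₂) (x : X) :
    ∃ (f : G → ℝ) (A e : ℝ) (a b : G), IsPseudocharacter f ∧ (∀ g, |f g| ≤ dist x (g • x) + A) ∧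
      0 < f a ∧ f b = f a ∧
      (∀ i j : ℕ, 0 < i → 0 < j → gromovProduct x (a ^ i • x) (b ^ j • x) ≤ e) ∧
      ∀ i j : ℕ, 0 < i → 0 < j → gromovProduct x (a⁻¹ ^ i • x) (b⁻¹ ^ j • x) ≤ e := by
  obtain ⟨δ, hδ, h4⟩ := hyp.fourPoint
  obtain ⟨C₁, hC₁⟩ := h₁.exists_morseOrbit hX h4 x
  obtain ⟨C₂, hC₂⟩ := h₂.exists_morseOrbit hX h4 x
  obtain ⟨C, hC⟩ := hind.exists_gromovProduct_le hX h4 hδ h₁ h₂ x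
  have hC0 : 0 ≤ C := (gromovProduct_nonneg _ _ _).trans (hC 0 0)
  -- The length lost at the four corners of a period, plus a net gain of `1`.
  set W := 8 * (C + 2 * δ) + 1 with hW
  have hW0 : 0 ≤ W := by positivity
  set B := C + 2 * (W + δ) + δ with hB
  set E := 2 * C + 4 * (W + δ) + 2 * δ with hE
  have hB0 : 0 ≤ B := by positivity
  have hE0 : 0 ≤ E := by positivity
  have m₁ := hC₁.mono (le_max_left C₁ C₂)
  have m₂ := hC₂.mono (le_max_right C₁ C₂)
  obtain ⟨L₀, hL₀⟩ := exists_overlap_le h4 hδ h₁ h₂ m₁ m₂ hne B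
  obtain ⟨L₁, hL₁⟩ := exists_overlap_le_of_reversed h4 hδ h₁ h₂ m₁ m₂ hne B
  set L := max (max L₀ L₁) (2 * B) with hL
  have l0 : L₀ ≤ L := (le_max_left _ _).trans (le_max_left _ _)
  have l1 : L₁ ≤ L := (le_max_right _ _).trans (le_max_left _ _)
  have l2 : 2 * B ≤ L := le_max_right _ _
  set R := 2 * (C + 2 * δ) + 3 * δ + L + 1 with hR
  obtain ⟨k₁, hk₁⟩ := h₁.exists_le_dist x R
  obtain ⟨k₂, hk₂⟩ := h₂.exists_le_dist x R
  set k := max k₁ k₂ with hk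
  have hk₁' : ∀ n, k ≤ n → R ≤ dist x (g₁ ^ n • x) := fun n hn => hk₁ n (by omega)
  have hk₂' : ∀ n, k ≤ n → R ≤ dist x (g₂ ^ n • x) := fun n hn => hk₂ n (by omega)
  -- The terms up to `E` prevent an `N`-segment from fitting into a `k`-piece; the others make `dist
  -- p q` exceed `2 * W + δ`.
  set R' := dist x (g₁ ^ k • x) + dist x (g₂ ^ k • x) + 2 * L + E + 2 * W + δ + 2 * C + 1 with hR'
  obtain ⟨N₁, hN₁⟩ := h₁.exists_le_dist x R'
  obtain ⟨N₂, hN₂⟩ := h₂.exists_le_dist x R'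
  set N := max k (max N₁ N₂) with hN
  have hN₁' := hN₁ N (by omega)
  have hN₂' := hN₂ N (by omega)
  have hlong := le_dist_cornerStep (N := N) hk₁' hk₂' (le_max_left _ _)
  set p := (g₁ ^ N)⁻¹ • x with hp
  set q := (g₂ ^ N)⁻¹ • x with hq
  have dk₁ : 0 ≤ dist x (g₁ ^ k • x) := dist_nonneg
  have dk₂ : 0 ≤ dist x (g₂ ^ k • x) := dist_nonneg
  have dp : dist x p = dist x (g₁ ^ N • x) := dist_smul_inv _ _
  have dq : dist x q = dist x (g₂ ^ N • x) := dist_smul_inv _ _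
  have hℓ : 2 * W + δ < dist p q := by
    have h1 : gromovProduct x p q ≤ C := by simpa [hp, hq] using hC (-N) (-N)
    rw [gromovProduct, dist_comm p x, dist_comm q x, dp, dq] at h1
    linarith
  have hℓ' : dist p q ≤ dist x (g₁ ^ N • x) + dist x (g₂ ^ N • x) := by
    rw [← dp, ← dq]; exact dist_triangle_left _ _ _
  have hWℓ : W ≤ dist p q := by linarith
  set a := cornerElement g₁ g₂⁻¹ N k with ha
  -- travelling forwards is cheap
  have hchain : DiscountChain G p q W x (a • x)
      (dist p q - W + (dist x (g₁ ^ k • x) + dist x (g₂ ^ k • x))) := by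
    have c0 : DiscountChain G p q W x (g₁ ^ N • p) 0 := by
      rw [hp, smul_inv_smul]; exact .nil
    have c1 := (c0.jump).move ((g₁ ^ N * (g₂ ^ N)⁻¹ * g₁ ^ k) • x) |>.move (a • x)
    have e1 : dist (g₁ ^ N • q) ((g₁ ^ N * (g₂ ^ N)⁻¹ * g₁ ^ k) • x) = dist x (g₁ ^ k • x) := by
      rw [hq, smul_smul, dist_mul_smul]
    have e2 : dist ((g₁ ^ N * (g₂ ^ N)⁻¹ * g₁ ^ k) • x) (a • x) = dist x (g₂ ^ k • x) := by
      rw [show a = g₁ ^ N * (g₂ ^ N)⁻¹ * g₁ ^ k * (g₂ ^ k)⁻¹ by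
        simp [ha, cornerElement, mul_assoc], dist_mul_smul, dist_smul_inv]
    rw [e1, e2] at c1
    convert c1 using 1
    ring
  have hforward := fun n => discountDist_pow_le hWℓ hchain n
  -- travelling backwards is not
  have hback : ∀ n : ℕ, dist x (a ^ n • x) ≤ discountDist G p q W (a ^ n • x) x := by
    intro n
    refine le_discountDist fun c hc => ?_
    -- This potential is `1`-Lipschitz and drops by the full distance on the way back; no move or
    -- jump lowers it by more than its cost.
    have := hc.sub_le (φ := fun z => (dist z x - dist z (a ^ n • x)) / 2) (fun z w => by
        have := dist_triangle z w x
        have := dist_triangle w z (a ^ n • x)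
        have := dist_comm z w
        linarith)
      (fun g => corner_jump_le h4 hδ hC0 hW0 hC hB l2
        (fun x' y' h h' n m s t b1 b2 b3 b4 b5 b6 b7 b8 =>
          (hL₀ x' y' h h' n m s t b1 b2 b3 b4 b5 b6 b7 b8).trans l0)
        (fun x' y' h h' n m s t b1 b2 b3 b4 b5 b6 b7 b8 =>
          (hL₁ x' y' h h' n m s t b1 b2 b3 b4 b5 b6 b7 b8).trans l1)
        (fun i => by linarith [hlong i]) hE (by linarith) (by linarith) hℓ n g rfl)
    simp only [dist_self, sub_zero, zero_sub] at this
    rw [dist_comm x] at this ⊢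
    linarith
  have hdist := le_dist_cornerElement_pow (N := N) (k := k) h4 hδ hC0 hC
    (fun i => by linarith [hlong i])
  set F : G → ℝ := fun g => discountCocycle G p q W x (g • x) with hF
  obtain ⟨D, hD⟩ := exists_discountCocycle_bound (G := G) hX h4 hδ hW0 hWℓ
  have hFD : ∀ b c, |F b + F c - F (b * c)| ≤ D := by
    intro b c
    have h1 := hD x (b • x) ((b * c) • x)
    rw [discountCocycle_neg x, mul_smul, discountCocycle_smul] at h1
    simpa only [hF, mul_smul, sub_eq_add_neg] using h1
  obtain ⟨f, hf, hfF, hlim⟩ := exists_homogenization hFD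
  have hfa : 1 ≤ f a := by
    refine ge_of_tendsto (hlim a) ?_
    filter_upwards [eventually_gt_atTop 0] with n hn
    have hn' : (0 : ℝ) < n := by exact_mod_cast hn
    rw [le_div_iff₀ hn', one_mul]
    have h1 := hforward n
    have h2 := hback n
    have h3 := hdist n
    simp only [hF, discountCocycle]
    have h5 : (n : ℝ) * (dist p q - W + (dist x (g₁ ^ k • x) + dist x (g₂ ^ k • x))) + n ≤
        n * (dist x (g₁ ^ N • x) + dist x (g₂ ^ N • x) + dist x (g₁ ^ k • x) +
          dist x (g₂ ^ k • x) - 8 * (C + 2 * δ)) := by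
      rw [← mul_add_one]
      exact mul_le_mul_of_nonneg_left (by linarith) hn'.le
    linarith
  refine ⟨f, D, C + 2 * δ + 2 * δ, a, (g₁ ^ N)⁻¹ * a * g₁ ^ N, hf, fun g => ?_, by linarith,
    hf.map_conj _ _, fun i j hi hj => ?_, fun i j hi hj => ?_⟩
  · have h1 := abs_discountCocycle_le (G := G) hWℓ x (g • x)
    have h2 := abs_sub_abs_le_abs_sub (f g) (F g)
    linarith [hfF g]
  · exact gromovProduct_cornerElement_pow_le h4 hδ hC0 hC (fun i => by linarith [hlong i]) i j hi hj
  · exact gromovProduct_cornerElement_inv_pow_le h4 hδ hC0 hC (fun i => by linarith [hlong i])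
      i j hi hj

end Main

end BestvinaFujiwara

theorem mainTheorem5 {G : Type u} [Group G] [Group.IsFinitelyPresented G]
    {X : Type v} [MetricSpace X] [MulAction G X]
    (hX : BestvinaFujiwara.IsQuasiTree X)
    (hG : BestvinaFujiwara.IsBestvinaFujiwaraAction G X) :
    ∃ h : G → ℝ, BestvinaFujiwara.IsBushy h := by
  have := hG.isometric
  obtain ⟨g₁, g₂, h₁, h₂, hind, hne⟩ := hG.exists_inequivalent
  obtain ⟨δ, -, h4⟩ := hG.hyperbolic.fourPoint
  obtain ⟨x, -⟩ := id h₁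
  obtain ⟨f, A, e, a, b, hf, hA, ha, hab, he, he'⟩ :=
    BestvinaFujiwara.exists_pseudocharacter hX hG.hyperbolic h₁ h₂ hind hne x
  refine ⟨f, hf, fun S hS hgen => ?_, fun S hS hgen => ?_⟩
  · exact BestvinaFujiwara.two_le_positiveEnds hX h4 hf hS hgen hA ha hab he
  · exact BestvinaFujiwara.two_le_negativeEnds hX h4 hf hS hgen hA
      (by rw [hf.map_inv]; linarith) (by rw [hf.map_inv, hf.map_inv, hab]) he'
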